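/- An \emph{orthotube} is a sequence of axis-parallel boxes $B_0, B_1, \dots, B_n$ in $\mathbb{R}^3$ ($n \ge 0$, arbitrary positive side lengths) such that every two consecutive boxes $B_i, B_{i+1}$ are glued face to face, that is, a face of $B_i$ coincides with the opposite-facing face of $B_{i+1}$, and no other two boxes share a face or a two-dimensional piece of a face (for $|i-j|\ge 2$ the intersection $B_i \cap B_j$ is empty, a point or a segment). Its \emph{rectangular faces} are the faces of the boxes other than those shared by two consecutive boxes. The \emph{face adjacency graph} has the rectangular faces as nodes, two of them being adjacent whenever they share an edge. A \emph{chain code} is a finite sequence $U = a_1 a_2 \cdots a_m$ with $a_i \in \{L, R, S\}$. A starting face $f_0$ and an initial direction on the surface determine its \emph{corresponding path} $f_0, f_1, \dots, f_{m+1}$ of faces: move over an edge of $f_0$ to the face $f_1$ on the other side of that edge of the surface; then, for $i = 1, \dots, m$, inside $f_i$ turn left ($L$), turn right ($R$) or keep going straight ($S$), as seen from outside, according to $a_i$, and move over the edge so reached to $f_{i+1}$. The \emph{cumulative quarter turning} of a chain code is the number of its symbols $R$ minus the number of its symbols $L$. The \emph{unfolding dual} of $U$ is the lattice path $p_0 =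 (0,0), p_1 = (0,1), p_2, \dots, p_{m+1}$ in the plane with unit steps that at each $p_i$ ($1 \le i \le m$) turns left, turns right or goes straight according to $a_i$; the \emph{corresponding unfolding} of $U$ consists of the unit squares centered at the points $p_0, \dots, p_{m+1}$. \textbf{Theorem.} Every orthotube has a dual-Hamiltonian grid unfolding. More precisely, for every orthotube there are a chain code $U$, a starting face and an initial direction such that: (1) the corresponding path is a Hamiltonian path $f_0, f_1, \dots, f_{m+1}$ of the face adjacency graph; (2) every prefix of $U$ has cumulative quarter turning in $\{-1, 0, +1\}$; (3) the corresponding unfolding of $U$ has no overlap: the unit squares have pairwise disjoint interiors; (4) cutting the surface along all edges of the rectangular faces except the common edges of $f_i$ and $f_{i+1}$ ($0 \le i \le m$) lets it unfold into the plane without overlap: the faces can be placed isometrically in the plane so that $f_i$ and $f_{i+1}$ agree on their common edge for every $i$, and the placed faces have pairwise disjoint interiors. -/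

import Mathlib

namespace OrthotubeUnfolding

/-! ### Signed axis directions and boxes -/

/-- One of the six directions `±x, ±y, ±z` of space. -/
structure Dir where
  axis : Fin 3
  sign : ℤˣ
deriving DecidableEq

namespace Dir

/-- The opposite direction. -/
def opp (d : Dir) : Dir := ⟨d.axis, -d.sign⟩

/-- The unit vector pointing in the direction `d`. -/
def vec (d : Dir) : Fin 3 → ℤ := Pi.single d.axis (d.sign : ℤ)

end Dir

/-- The closed axis-parallel box with the corners of `B`
(the coercion of `BoxIntegral.Box` to sets is half-open). -/
def closedBox (B : BoxIntegral.Box (Fin 3)) : Set (EuclideanSpace ℝ (Fin 3)) :=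
  {x | ∀ a, B.lower a ≤ x a ∧ x a ≤ B.upper a}

/-- The coordinate, along the axis of `d`, of the face of `B` with outward normal `d`. -/
def side (B : BoxIntegral.Box (Fin 3)) (d : Dir) : ℝ :=
  if d.sign = 1 then B.upper d.axis else B.lower d.axis

/-- The (closed, rectangular) face of `B` with outward normal `d`. -/
def boxFace (B : BoxIntegral.Box (Fin 3)) (d : Dir) : Set (EuclideanSpace ℝ (Fin 3)) :=
  {x | x ∈ closedBox B ∧ x d.axis = side B d}

/-- For `d` orthogonal to `n`: the edge that bounds the face `boxFace B n` in direction `d`. -/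
def boxEdge (B : BoxIntegral.Box (Fin 3)) (n d : Dir) : Set (EuclideanSpace ℝ (Fin 3)) :=
  boxFace B n ∩ boxFace B d

/-! ### Orthotubes -/

/-- An orthotube with boxes `B₀, …, Bₙ`, of arbitrary (positive) side lengths.  Consecutive boxes
are glued along a common face, from opposite sides.  No other two boxes have a two-dimensional
piece of face (or more) in common: the intersection of two axis-parallel boxes is a possibly
degenerate box, and it is collinear exactly if it is empty, a point or a segment. -/
structure Orthotube (n : ℕ) where
  box : Fin (n + 1) → BoxIntegral.Box (Fin 3)
  glued : ∀ i : Fin n, ∃ d : Dir, boxFace (box i.castSucc) d = boxFace (box i.succ) d.opp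
  apart : ∀ i j : Fin (n + 1), i.val + 1 < j.val →
    Collinear ℝ (closedBox (box i) ∩ closedBox (box j))

/-- The face with outward normal `normal` of the box with index `box`. -/
structure Face (n : ℕ) where
  box : Fin (n + 1)
  normal : Dir
deriving DecidableEq

namespace Orthotube

variable {n : ℕ} (T : Orthotube n)

/-- The boxes `i` and `j` are consecutive, and `j` is glued to `i` along the face of `i` with
outward normal `d`. -/
def Glued (i : Fin (n + 1)) (d : Dir) (j : Fin (n + 1)) : Prop :=
  (i.val + 1 = j.val ∨ j.val + 1 = i.val) ∧ boxFace (T.box i) d = boxFace (T.box j) d.opp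

/-- The rectangular faces of the surface of the orthotube: all faces of the boxes, except those
shared by two consecutive boxes. -/
def SurfaceFace : Type :=
  {f : Face n // ∀ j, ¬ T.Glued f.box f.normal j}

instance : DecidableEq T.SurfaceFace :=
  inferInstanceAs (DecidableEq {f : Face n // ∀ j, ¬ T.Glued f.box f.normal j})

/-- The rectangle in space occupied by a face. -/
def rect (f : T.SurfaceFace) : Set (EuclideanSpace ℝ (Fin 3)) :=
  boxFace (T.box f.1.box) f.1.normal

/-- The face adjacency graph: two surface faces are adjacent when they share an edge. -/
def faceAdjacencyGraph : SimpleGraph T.SurfaceFace where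
  Adj f g := f ≠ g ∧ ∃ d e : Dir, d.axis ≠ f.1.normal.axis ∧ e.axis ≠ g.1.normal.axis ∧
    boxEdge (T.box f.1.box) f.1.normal d = boxEdge (T.box g.1.box) g.1.normal e
  symm := ⟨fun _ _ h => by
    obtain ⟨hne, d, e, hd, he, h⟩ := h
    exact ⟨hne.symm, e, d, he, hd, h.symm⟩⟩
  loopless := ⟨fun _ h => h.1 rfl⟩

/-- `T.Crosses f d g e`: moving on the surface, one leaves the face `f` in the direction `d`
(tangent to `f`) through the edge of `f` on that side, and enters the face `g` with the direction
`e` (tangent to `g`).  The surface may be convex, flat or reflex at that edge. -/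
inductive Crosses : T.SurfaceFace → Dir → T.SurfaceFace → Dir → Prop
  | convex (f g : T.SurfaceFace) (d : Dir) (hd : d.axis ≠ f.1.normal.axis)
      (hg : g.1 = ⟨f.1.box, d⟩) :
      Crosses f d g f.1.normal.opp
  | flat (f g : T.SurfaceFace) (d : Dir) (hd : d.axis ≠ f.1.normal.axis) (j : Fin (n + 1))
      (hj : T.Glued f.1.box d j) (hg : g.1 = ⟨j, f.1.normal⟩) :
      Crosses f d g d
  | reflex (f g : T.SurfaceFace) (d : Dir) (hd : d.axis ≠ f.1.normal.axis) (j k : Fin (n + 1))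
      (hj : T.Glued f.1.box d j) (hk : T.Glued j f.1.normal k) (hg : g.1 = ⟨k, d.opp⟩) :
      Crosses f d g f.1.normal

end Orthotube

/-! ### Chain codes -/

/-- Left turn, right turn, or going straight. -/
inductive Turn
  | L
  | R
  | S

/-- A chain code `a₁ a₂ ⋯ aₙ`. -/
abbrev ChainCode := List Turn

/-- The quarter turning of a single symbol. -/
def Turn.quarter : Turn → ℤ
  | .L => -1
  | .R => 1
  | .S => 0

/-- The cumulative quarter turning of a chain code. -/
def quarterTurning (U : ChainCode) : ℤ := (U.map Turn.quarter).sum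

/-- `t.Exits ν d e`: on a face with outward normal `ν`, seen from outside, the symbol `t` changes
the direction of motion from `d` to `e`. -/
def Turn.Exits : Turn → Dir → Dir → Dir → Prop
  | .L, ν, d, e => e.vec = crossProduct ν.vec d.vec
  | .R, ν, d, e => e.vec = crossProduct d.vec ν.vec
  | .S, _, d, e => e = d

namespace Orthotube

variable {n : ℕ} (T : Orthotube n)

/-- `T.Follows f d U l`: having entered the face `f` with direction `d`, the chain code `U` is
executed on the surface, and `l` is the list of faces visited, starting with `f`. -/
inductive Follows : T.SurfaceFace → Dir → ChainCode → List T.SurfaceFace → Prop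
  | nil (f : T.SurfaceFace) (d : Dir) : Follows f d [] [f]
  | cons (f g : T.SurfaceFace) (d d' e : Dir) (t : Turn) (U : ChainCode)
      (l : List T.SurfaceFace) (ht : t.Exits f.1.normal d d') (hc : T.Crosses f d' g e)
      (hl : Follows g e U l) : Follows f d (t :: U) (f :: l)

/-- `l = [f₀, f₁, …, fₙ₊₁]` is the path corresponding to the chain code `U = a₁ ⋯ aₙ` for the
starting face `f₀` and some initial direction `d` (which determines `f₁`). -/
def IsCorrespondingPath (U : ChainCode) (l : List T.SurfaceFace) : Prop :=
  ∃ (f₀ f₁ : T.SurfaceFace) (d e : Dir) (l' : List T.SurfaceFace),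
    l = f₀ :: l' ∧ T.Crosses f₀ d f₁ e ∧ T.Follows f₁ e U l'

/-- The chain `l` of surface faces, kept attached along the common edge of each two successive
faces (all other edges being cut), unfolds into the plane without overlap: every face is placed
in the plane isometrically, successive faces agree on their common edge, and any two faces have
images with disjoint interiors. -/
def UnfoldsWithoutOverlap (l : List T.SurfaceFace) : Prop :=
  ∃ φ : T.SurfaceFace → EuclideanSpace ℝ (Fin 3) → EuclideanSpace ℝ (Fin 2),
    (∀ f ∈ l, Isometry ((T.rect f).domRestrict (φ f))) ∧
    l.IsChain (fun f g => Set.EqOn (φ f) (φ g) (T.rect f ∩ T.rect g)) ∧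
    l.Pairwise (fun f g => Disjoint (interior (φ f '' T.rect f)) (interior (φ g '' T.rect g)))

end Orthotube

/-! ### The unfolding dual and the corresponding unfolding by unit squares -/

/-- The effect of a symbol on a heading in the plane. -/
def Turn.rotate : Turn → ℤ × ℤ → ℤ × ℤ
  | .L, (x, y) => (-y, x)
  | .R, (x, y) => (y, -x)
  | .S, v => v

/-- The rest of the unfolding dual, from the vertex `p` that was reached with heading `v`. -/
def unfoldingDualFrom : ℤ × ℤ → ℤ × ℤ → ChainCode → List (ℤ × ℤ)
  | p, _, [] => [p]
  | p, v, t :: U => p :: unfoldingDualFrom (p + t.rotate v) (t.rotate v) U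

/-- The unfolding dual `p₀ = (0,0), p₁ = (0,1), p₂, …, pₙ₊₁` of a chain code `a₁ ⋯ aₙ`; the path
turns at `pᵢ` according to `aᵢ`. -/
def unfoldingDual (U : ChainCode) : List (ℤ × ℤ) :=
  (0, 0) :: unfoldingDualFrom (0, 1) (0, 1) U

/-- The closed unit square centered at `p`. -/
def unitSquare (p : ℤ × ℤ) : Set (ℝ × ℝ) :=
  Set.Icc ((p.1 : ℝ) - 1 / 2) ((p.1 : ℝ) + 1 / 2) ×ˢ
    Set.Icc ((p.2 : ℝ) - 1 / 2) ((p.2 : ℝ) + 1 / 2)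

/-- The corresponding unfolding of a chain code, by unit squares centered at the vertices of the
unfolding dual, has no overlap. -/
def SquaresDoNotOverlap (U : ChainCode) : Prop :=
  (unfoldingDual U).Pairwise
    (fun p q => Disjoint (interior (unitSquare p)) (interior (unitSquare q)))

end OrthotubeUnfolding

namespace OrthotubeUnfolding

/-! ### A combinatorial model of the surface -/

/-! Overlap is controlled by the turning alone. If all partial turnings lie in {-1, 0, 1}, the
unfolding heads only up, left or right, and never goes directly from left to right or back. It is
therefore a staircase, and any two of its rectangles are separated by a horizontal or vertical line
(`Staircase.pairwise`). This settles the unit squares. It also settles the actual faces: boxes are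
glued along whole faces, so successive faces share a full edge and can be laid flat one after the
other (`Orthotube.Crosses.exists_placement`).

It remains to find a Hamiltonian path with bounded turning. The tube is encoded by the sequence `e`
of gluing directions, continued by one fictitious straight step at each end, so that every box has
exactly four free faces. The sequence never reverses at once or after one intermediate step, since
two non-consecutive boxes would then meet in at least a rectangle (`Orthotube.exists_directions`).
The path goes from one end cap through all free faces to the other cap. It is composed of sweeps,
each covering one, two or three consecutive boxes by a code from a fixed list or its mirror image.

A sweep depends on the side and the turning with which it starts, and the right start depends on the
rest of the tube. Pairs of starts are therefore carried along, and only one member of each pair has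
to extend to the end. Up to rotation there are five kinds of pair, two after a straight piece and
three after a bend. A finite computation (`pairsRecur_straight`, `pairsRecur_bend`) shows that from
each of them, however the tube continues, a new pair is reached within six steps, each member of
which is reached from some member of the old pair; should the tube end earlier, a sweep to the end
is available. Induction from the far end then selects the correct members
(`IsGoodPair.exists_sweep`). -/

/-- The six signed axis directions, as an enumeration. -/
inductive SixDir
  | xp | xm | yp | ym | zp | zm
deriving DecidableEq

namespace SixDir

/-- The opposite direction. -/
def opp : SixDir → SixDir
  | xp => xm | xm => xp | yp => ym | ym => yp | zp => zm | zm => zp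

/-- The direction to the left of `d` on a face with outward normal `n`
(`d` itself when it is parallel to `n`). -/
def left : SixDir → SixDir → SixDir
  | xp, yp | xm, ym | yp, xm | ym, xp => zp
  | xp, ym | xm, yp | yp, xp | ym, xm => zm
  | yp, zp | ym, zm | zp, ym | zm, yp => xp
  | yp, zm | ym, zp | zp, yp | zm, ym => xm
  | zp, xp | zm, xm | xp, zm | xm, zp => yp
  | zp, xm | zm, xp | xp, zp | xm, zm => ym
  | _, d => d

/-- All directions. -/
def all : List SixDir := [xp, xm, yp, ym, zp, zm]

theorem mem_all (d : SixDir) : d ∈ all := by cases d <;> decide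

/-- The rotation taking `xp` to `a` and `zp` to `c`. -/
def frame (a c : SixDir) : SixDir → SixDir
  | xp => a
  | xm => a.opp
  | zp => c
  | zm => c.opp
  | yp => left c a
  | ym => (left c a).opp

end SixDir

open SixDir

/-- The direction of motion after the turn `t`, on a face with outward normal `n` that was entered
with direction `d`. -/
def Turn.apply : Turn → SixDir → SixDir → SixDir
  | .L, n, d => left n d
  | .R, n, d => left d n
  | .S, _, d => d

/-- The reflected turn. -/
def Turn.mirror : Turn → Turn
  | .L => .R
  | .R => .L
  | .S => .S

/-- Total quarter turning of two symbols, if it is still one of `-1, 0, 1`; the quarter turnings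
themselves are recorded as symbols. -/
def Turn.add : Turn → Turn → Option Turn
  | .S, t => some t
  | .L, .S => some .L
  | .L, .R => some .S
  | .R, .S => some .R
  | .R, .L => some .S
  | _, _ => none

instance : DecidableEq Turn := fun a b => by
  cases a <;> cases b <;> first | exact isTrue rfl | exact isFalse (by simp)

/-- A position on the tube: one is on the face with outward normal `normal` of the box with
index `box` and about to leave it in the direction `out`. -/
structure Pos where
  box : ℕ
  normal : SixDir
  out : SixDir

/-- The face entered from a position, and (as `out`) the direction with which it is entered.  The
box `j + 1` of the tube is glued to the box `j` in the direction `e j`. -/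
def Pos.cross (e : ℕ → SixDir) (s : Pos) : Pos :=
  if s.out = e s.box then
    if s.normal = e (s.box + 1) then ⟨s.box + 2, s.out.opp, s.normal⟩
    else ⟨s.box + 1, s.normal, s.out⟩
  else if s.out = (e (s.box - 1)).opp then
    if s.normal = (e (s.box - 2)).opp then ⟨s.box - 2, s.out.opp, s.normal⟩
    else ⟨s.box - 1, s.normal, s.out⟩
  else ⟨s.box, s.out, s.normal.opp⟩

/-- Change the direction of motion on a face that was just entered. -/
def Pos.turn (s : Pos) (t : Turn) : Pos := ⟨s.box, s.normal, t.apply s.normal s.out⟩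

/-! ### Sweeping codes and the finite search. -/

/-- A side of the tube, and a quarter turning. -/
abbrev SideTurn := SixDir × Turn

/-- Execute a chain code from a position, keeping track of the turning `h` and of the visited faces
`vis`.  Succeeds if exactly the faces of the boxes `1, …, k` have been visited, and one is about to
leave box `k` towards box `k + 1`; returns the side along which this happens, and the turning. -/
def sweepAux (w : ℕ → SixDir) (k : ℕ) :
    Pos → Turn → List (ℕ × SixDir) → List Turn → Option SideTurn
  | s, h, vis, [] =>
    if s.box = k ∧ s.out = w k ∧
        -- Together the two tests say that the visited faces are exactly the free faces of the boxes
        -- `1, …, k`.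
        (∀ f ∈ vis, f.2 ≠ (w (f.1 - 1)).opp ∧ f.2 ≠ w f.1) ∧
        (∀ j ∈ List.range k, ∀ f ∈ SixDir.all, f = (w j).opp ∨ f = w (j + 1) ∨ (j + 1, f) ∈ vis)
    then some (s.normal, h) else none
  | s, h, vis, t :: U =>
    let q := s.cross w
    if 1 ≤ q.box ∧ q.box ≤ k ∧ (q.box, q.normal) ∉ vis then
      match h.add t with
      | none => none
      | some h' => sweepAux w k (q.turn t) h' ((q.box, q.normal) :: vis) U
    else none

/-- Sweep the boxes between the first and the last direction of `w` by a given chain code. -/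
def sweepBy (w : List SixDir) (s : SideTurn) (U : List Turn) : Option SideTurn :=
  sweepAux (fun j => w.getD j .xp) (w.length - 1) ⟨0, s.1, w.getD 0 .xp⟩ s.2 [] U

/-- Chain codes for sweeping one, two or three boxes, up to reflection. -/
def sweepCodes : ℕ → List (List Turn)
  | 1 => [[.L, .S, .S, .R], [.L, .R, .S, .L], [.L, .S, .R, .L], [.L, .R, .L, .R]]
  | 2 => [[.L, .L, .R, .L, .R, .S, .S, .R], [.L, .L, .S, .R, .L, .R, .R, .L],
    [.L, .R, .L, .L, .R, .R, .S, .L], [.S, .L, .S, .S, .R, .L, .R, .R]]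
  | 3 => [[.L, .R, .L, .S, .L, .R, .S, .S, .S, .L, .R, .S],
    [.L, .R, .L, .S, .L, .R, .S, .S, .L, .S, .R, .L],
    [.L, .R, .L, .R, .R, .L, .S, .S, .L, .R, .S, .R],
    [.S, .S, .L, .S, .S, .S, .S, .R, .L, .L, .R, .R],
    [.S, .L, .R, .L, .L, .R, .S, .S, .R, .L, .S, .R],
    [.L, .L, .R, .L, .S, .S, .R, .S, .L, .S, .R, .L],
    [.L, .L, .R, .L, .S, .S, .R, .S, .L, .S, .S, .R],
    [.L, .L, .R, .L, .S, .S, .R, .S, .L, .R, .S, .L],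
    [.L, .R, .S, .S, .S, .S, .L, .R, .R, .L, .S, .R],
    [.L, .R, .L, .S, .L, .R, .S, .S, .R, .S, .L, .R],
    [.S, .L, .R, .S, .L, .S, .L, .R, .S, .S, .R, .L],
    [.L, .R, .L, .S, .L, .R, .S, .S, .R, .S, .S, .L],
    [.L, .R, .L, .S, .L, .R, .S, .S, .S, .R, .L, .S],
    [.S, .L, .R, .L, .L, .R, .S, .S, .L, .R, .S, .L],
    [.S, .L, .R, .L, .L, .R, .S, .S, .L, .S, .S, .R],
    [.L, .S, .L, .R, .L, .S, .R, .S, .S, .R, .L, .S]]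
  | _ => []

/-- All results of sweeping with one of the chain codes. -/
def sweepAll (w : List SixDir) (s : SideTurn) : List SideTurn :=
  (sweepCodes (w.length - 1)).flatMap fun U =>
    (sweepBy w s U).toList ++ (sweepBy w s (U.map Turn.mirror)).toList

/-- Pairs of sides, relative to the motion in direction `xp` after a straight piece. -/
def straightPairs : List (List SideTurn) := [[(zp, .S), (zm, .S)], [(zp, .R), (zp, .L)]]

/-- Pairs of sides, relative to the motion in direction `xp` after a bend from direction `zp`. -/
def bendPairs : List (List SideTurn) :=
  [[(yp, .S), (zp, .L)], [(ym, .S), (zp, .R)], [(yp, .R), (ym, .L)]]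

/-- `T` contains, up to a rotation, one of the pairs from the list. -/
def containsPair (p d : SixDir) (T : List SideTurn) : Prop :=
  if p = d then
    ∃ c ∈ SixDir.all, left c d ≠ d ∧ ∃ Q ∈ straightPairs, ∀ s ∈ Q, (frame d c s.1, s.2) ∈ T
  else ∃ Q ∈ bendPairs, ∀ s ∈ Q, (frame d p s.1, s.2) ∈ T

instance (p d : SixDir) (T : List SideTurn) : Decidable (containsPair p d T) := by
  unfold containsPair; infer_instance

/-- The results of sweeping from the sides recorded in `W`; an entry `(w, S)` of `W` records sides
`S` at the end of the tube that precedes the directions in `w`. -/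
def sweepFrom (W : List (List SixDir × List SideTurn)) : List SideTurn :=
  W.flatMap fun p => p.2.flatMap (sweepAll p.1)

/-- Whatever the next directions are, one of the pairs is reached within `m` steps. -/
def pairsRecur : ℕ → List (List SixDir × List SideTurn) → SixDir → SixDir → Bool
  | 0, _, _, _ => false
  | m + 1, W, p, d => SixDir.all.all fun c =>
    -- These two continuations are impossible in an orthotube.
    decide (c = d.opp) || decide (c = p.opp) ||
    (let W' := W.map fun q => (q.1 ++ [c], q.2)
     let T := sweepFrom W'
     -- The fictitious last step is straight, so a straight continuation may be the end of the tube;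
     -- some sweep must then exist.
     (!decide (c = d) || !T.isEmpty) &&
      -- The entries are ordered by the length of their words, and codes cover at most three boxes,
      -- so older entries can be dropped.
      (decide (containsPair d c T) || pairsRecur m ((([c], T) :: W').take 3) d c))

instance : Fintype SixDir := ⟨⟨SixDir.all, by decide⟩, SixDir.mem_all⟩

/-! ### Rotations -/

/-- An orientation preserving permutation of the signed axis directions. -/
structure IsRotation (g : SixDir → SixDir) : Prop where
  injective : Function.Injective g
  map_opp : ∀ a, g a.opp = (g a).opp
  map_left : ∀ a b, g (left a b) = left (g a) (g b)

theorem IsRotation.comp {g g' : SixDir → SixDir} (hg : IsRotation g) (hg' : IsRotation g') :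
    IsRotation (g ∘ g') :=
  ⟨hg.injective.comp hg'.injective, fun a => by simp [hg.map_opp, hg'.map_opp],
    fun a b => by simp [hg.map_left, hg'.map_left]⟩

theorem IsRotation.surjective {g : SixDir → SixDir} (hg : IsRotation g) :
    Function.Surjective g :=
  Finite.injective_iff_surjective.mp hg.injective

theorem isRotation_frame {a c : SixDir} (h : left c a ≠ a) : IsRotation (frame a c) := by
  refine ⟨?_, ?_, ?_⟩ <;> revert a c <;> decide +kernel

theorem left_ne_of_ne {a c : SixDir} (h₁ : a ≠ c) (h₂ : a ≠ c.opp) : left c a ≠ a := by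
  revert a c; decide

theorem SixDir.opp_ne (a : SixDir) : a.opp ≠ a := by cases a <;> decide

theorem IsRotation.map_apply {g : SixDir → SixDir} (hg : IsRotation g) (t : Turn) (n d : SixDir) :
    g (t.apply n d) = t.apply (g n) (g d) := by
  cases t <;> simp [Turn.apply, hg.map_left]

/-- Rotate a side. -/
def SideTurn.map (g : SixDir → SixDir) (s : SideTurn) : SideTurn := (g s.1, s.2)

/-- Rotate a position, and shift the indices of the boxes. -/
def Pos.map (g : SixDir → SixDir) (a : ℕ) (s : Pos) : Pos := ⟨a + s.box, g s.normal, g s.out⟩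

theorem Pos.cross_mk (e : ℕ → SixDir) (j : ℕ) (f o : SixDir) :
    Pos.cross e ⟨j, f, o⟩ =
      if o = e j then
        if f = e (j + 1) then ⟨j + 2, o.opp, f⟩ else ⟨j + 1, f, o⟩
      else if o = (e (j - 1)).opp then
        if f = (e (j - 2)).opp then ⟨j - 2, o.opp, f⟩ else ⟨j - 1, f, o⟩
      else ⟨j, o, f.opp⟩ := rfl

/-- The word `w` describes the tube only on the indices `0, …, k`. If a crossing ends in one of the
boxes `1, …, k`, the directions that decide it lie in this range, and none of the index subtractions
that matter is truncated. -/
theorem IsRotation.cross_map {g : SixDir → SixDir} (hg : IsRotation g) {w e : ℕ → SixDir}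
    {a k : ℕ} (hw : ∀ i ≤ k, e (a + i) = g (w i)) {s : Pos} (hs : s.box ≤ k)
    (h₁ : 1 ≤ (s.cross w).box) (h₂ : (s.cross w).box ≤ k) :
    (s.map g a).cross e = (s.cross w).map g a := by
  obtain ⟨j, f, o⟩ := s
  rw [Pos.map, Pos.cross_mk]
  rw [Pos.cross_mk] at h₁ h₂ ⊢
  have hs : j ≤ k := hs
  have h0 : g o = e (a + j) ↔ o = w j := by rw [hw j hs, hg.injective.eq_iff]
  by_cases ho : o = w j
  · rw [if_pos ho] at h₁ h₂ ⊢
    rw [if_pos (h0.2 ho)]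
    have hj : j + 1 ≤ k := by split_ifs at h₂ <;> simp at h₂ <;> omega
    have h1 : g f = e (a + j + 1) ↔ f = w (j + 1) := by
      rw [add_assoc, hw (j + 1) hj, hg.injective.eq_iff]
    by_cases hf : f = w (j + 1)
    · rw [if_pos hf, if_pos (h1.2 hf), Pos.map, hg.map_opp, add_assoc]
    · rw [if_neg hf, if_neg (mt h1.1 hf), Pos.map, add_assoc]
  · rw [if_neg ho] at h₁ h₂ ⊢
    rw [if_neg (mt h0.1 ho)]
    by_cases hb : o = (w (j - 1)).opp
    · rw [if_pos hb] at h₁ h₂ ⊢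
      have hj1 : 1 ≤ j - 1 := by split_ifs at h₁ <;> simp at h₁ <;> omega
      have h2 : g o = (e (a + j - 1)).opp ↔ o = (w (j - 1)).opp := by
        rw [show a + j - 1 = a + (j - 1) by omega, hw _ (by omega), ← hg.map_opp,
          hg.injective.eq_iff]
      have h3 : g f = (e (a + j - 2)).opp ↔ f = (w (j - 2)).opp := by
        rw [show a + j - 2 = a + (j - 2) by omega, hw _ (by omega), ← hg.map_opp,
          hg.injective.eq_iff]
      rw [if_pos (h2.2 hb)]
      by_cases hf : f = (w (j - 2)).opp
      · rw [if_pos hf, if_pos (h3.2 hf), Pos.map, hg.map_opp]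
        simp only [Pos.mk.injEq, and_true]; omega
      · rw [if_neg hf, if_neg (mt h3.1 hf), Pos.map]
        simp only [Pos.mk.injEq, and_true]; omega
    · rw [if_neg hb] at h₁ h₂ ⊢
      have hj1 : 1 ≤ j := h₁
      have h2 : g o = (e (a + j - 1)).opp ↔ o = (w (j - 1)).opp := by
        rw [show a + j - 1 = a + (j - 1) by omega, hw _ (by omega), ← hg.map_opp,
          hg.injective.eq_iff]
      rw [if_neg (mt h2.1 hb), Pos.map, hg.map_opp]

theorem IsRotation.turn_map {g : SixDir → SixDir} (hg : IsRotation g) (a : ℕ) (s : Pos) (t : Turn) :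
    (s.turn t).map g a = (s.map g a).turn t := by
  simp [Pos.turn, Pos.map, hg.map_apply]

/-! ### Sweeping a part of the tube -/

/-- Cross an edge, and then turn on the new face. -/
def Pos.step (e : ℕ → SixDir) (s : Pos) (t : Turn) : Pos := (s.cross e).turn t

/-- The faces entered when executing a chain code from a position. -/
def trail (e : ℕ → SixDir) : Pos → List Turn → List (ℕ × SixDir)
  | _, [] => []
  | s, t :: U => ((s.step e t).box, (s.step e t).normal) :: trail e (s.step e t) U

theorem trail_append (e : ℕ → SixDir) (s : Pos) (U V : List Turn) :
    trail e s (U ++ V) = trail e s U ++ trail e (U.foldl (Pos.step e) s) V := by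
  induction U generalizing s with
  | nil => rfl
  | cons t U ih => simp [trail, ih]

/-- The face with outward normal `f` of box `j` is not shared with another box of the tube. -/
def IsFree (e : ℕ → SixDir) (j : ℕ) (f : SixDir) : Prop := f ≠ (e (j - 1)).opp ∧ f ≠ e j

/-- Some chain code, entering from the side `s` of box `a` into the next box, visits each face of
the boxes `a + 1, …, b` exactly once, and ends on the side `s'` of box `b` moving towards the next
box; the turnings stay between `-1` and `1`. -/
def Sweep (e : ℕ → SixDir) (a b : ℕ) (s s' : SideTurn) : Prop :=
  ∃ U : List Turn, U.foldlM Turn.add s.2 = some s'.2 ∧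
    U.foldl (Pos.step e) ⟨a, s.1, e a⟩ = ⟨b, s'.1, e b⟩ ∧
    (trail e ⟨a, s.1, e a⟩ U).Nodup ∧
    ∀ j f, (j, f) ∈ trail e ⟨a, s.1, e a⟩ U ↔ (a < j ∧ j ≤ b) ∧ IsFree e j f

theorem Sweep.refl (e : ℕ → SixDir) (a : ℕ) (s : SideTurn) : Sweep e a a s s :=
  ⟨[], rfl, rfl, List.nodup_nil, fun j f => by simp [trail]; try omega⟩

/-- The two trails lie in disjoint ranges of boxes, so their concatenation repeats no face. -/
theorem Sweep.trans {e : ℕ → SixDir} {a b c : ℕ} {s s' s'' : SideTurn} (hab : a ≤ b) (hbc : b ≤ c)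
    (h : Sweep e a b s s') (h' : Sweep e b c s' s'') : Sweep e a c s s'' := by
  obtain ⟨U, h₁, h₂, h₃, h₄⟩ := h
  obtain ⟨V, k₁, k₂, k₃, k₄⟩ := h'
  refine ⟨U ++ V, by simp [List.foldlM_append, h₁, k₁], by simp [h₂, k₂], ?_, ?_⟩
  · rw [trail_append, h₂, List.nodup_append]
    refine ⟨h₃, k₃, ?_⟩
    rintro ⟨j, f⟩ hx _ hy rfl
    have := (h₄ j f).1 hx
    have := (k₄ j f).1 hy
    omega
  · intro j f
    rw [trail_append, h₂, List.mem_append, h₄, k₄, ← or_and_right]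
    refine and_congr_left fun _ => ?_
    omega

/-- Soundness of the executable check, transported to the tube by a rotation and a shift. The
invariant splits the free faces into those already in `vis` and those in the list `l` still to be
entered. -/
theorem sweepAux_spec {g : SixDir → SixDir} (hg : IsRotation g) {w e : ℕ → SixDir}
    {a k : ℕ} (hw : ∀ i ≤ k, e (a + i) = g (w i)) (U : List Turn) :
    ∀ (s : Pos) (h : Turn) (vis : List (ℕ × SixDir)) (r : SideTurn), s.box ≤ k →
      (∀ f ∈ vis, 1 ≤ f.1 ∧ f.1 ≤ k) → sweepAux w k s h vis U = some r →
      U.foldlM Turn.add h = some r.2 ∧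
      U.foldl (Pos.step e) (s.map g a) = ⟨a + k, g r.1, e (a + k)⟩ ∧
      ∃ l : List (ℕ × SixDir), trail e (s.map g a) U = l.map (fun f => (a + f.1, g f.2)) ∧
        l.Nodup ∧ (∀ f ∈ l, f ∉ vis) ∧
        ∀ j f, (j, f) ∈ l ∨ (j, f) ∈ vis ↔ (1 ≤ j ∧ j ≤ k) ∧ IsFree w j f := by
  induction U with
  | nil =>
    intro s h vis r hs hvis hr
    rw [sweepAux] at hr
    split_ifs at hr with hc
    obtain ⟨h₁, h₂, h₃, h₄⟩ := hc
    obtain rfl := Option.some.inj hr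
    refine ⟨rfl, ?_, [], rfl, List.nodup_nil, by simp, ?_⟩
    · simp [Pos.map, h₁, h₂, hw k le_rfl]
    · intro j f
      simp only [List.not_mem_nil, false_or]
      constructor
      · exact fun hf => ⟨hvis _ hf, h₃ _ hf⟩
      · rintro ⟨⟨h1, h2⟩, h3, h4⟩
        obtain ⟨j, rfl⟩ := Nat.exists_eq_add_of_le' h1
        have := h₄ j (List.mem_range.2 h2) f (SixDir.mem_all f)
        exact (this.resolve_left h3).resolve_left h4
  | cons t U ih =>
    intro s h vis r hs hvis hr
    rw [sweepAux] at hr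
    split_ifs at hr with hc
    obtain ⟨h₁, h₂, h₃⟩ := hc
    cases ht : h.add t with
    | none => rw [ht] at hr; cases hr
    | some h' =>
      rw [ht] at hr
      have hstep : (s.map g a).step e t = ((s.cross w).turn t).map g a := by
        rw [Pos.step, hg.cross_map hw hs h₁ h₂, hg.turn_map]
      obtain ⟨k₁, k₂, l, k₃, k₄, k₅, k₆⟩ := ih ((s.cross w).turn t) h' _ r h₂ (by
        intro f hf
        rcases List.mem_cons.1 hf with rfl | hf
        · exact ⟨h₁, h₂⟩
        · exact hvis f hf) hr
      refine ⟨by simp [ht, k₁], by simpa [hstep] using k₂,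
        ((s.cross w).box, (s.cross w).normal) :: l, ?_, ?_, ?_, ?_⟩
      · rw [trail, hstep, k₃]; rfl
      · exact List.nodup_cons.2 ⟨fun hm => k₅ _ hm (by simp), k₄⟩
      · intro f hf
        rcases List.mem_cons.1 hf with rfl | hf
        · exact h₃
        · exact fun hv => k₅ f hf (List.mem_cons_of_mem _ hv)
      · intro j f
        rw [← k₆ j f, List.mem_cons, List.mem_cons]
        tauto

theorem sweepBy_spec {g : SixDir → SixDir} (hg : IsRotation g) {w : List SixDir} {e : ℕ → SixDir}
    {a k : ℕ} (hk : w.length = k + 1) (hw : ∀ i ≤ k, e (a + i) = g (w.getD i .xp)) {U : List Turn}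
    {s r : SideTurn} (hr : sweepBy w s U = some r) :
    Sweep e a (a + k) (s.map g) (r.map g) := by
  rw [sweepBy, hk, Nat.add_sub_cancel] at hr
  obtain ⟨h₁, h₂, l, h₃, h₄, -, h₆⟩ :=
    sweepAux_spec hg (w := fun j => w.getD j .xp) hw U _ _ _ _ (Nat.zero_le k) (by simp) hr
  have hs : Pos.map g a ⟨0, s.1, w.getD 0 .xp⟩ = ⟨a, g s.1, e a⟩ := by
    simpa [Pos.map] using (hw 0 (Nat.zero_le k)).symm
  rw [hs] at h₂ h₃
  refine ⟨U, h₁, h₂, ?_, ?_⟩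
  · change (trail e ⟨a, g s.1, e a⟩ U).Nodup
    rw [h₃]
    refine h₄.map fun x y hxy => ?_
    simp only [Prod.mk.injEq, hg.injective.eq_iff] at hxy
    exact Prod.ext (by omega) hxy.2
  · intro j f
    change (j, f) ∈ trail e ⟨a, g s.1, e a⟩ U ↔ _
    rw [h₃]
    obtain ⟨f, rfl⟩ := hg.surjective f
    simp only [List.mem_map, Prod.mk.injEq, hg.injective.eq_iff, Prod.exists]
    have key : ∀ i, 1 ≤ i → i ≤ k → (IsFree (fun j => w.getD j .xp) i f ↔ IsFree e (a + i) (g f)) := by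
      intro i h1 h2
      rw [IsFree, IsFree, show a + i - 1 = a + (i - 1) by omega, hw i h2, hw (i - 1) (by omega),
        ← hg.map_opp, hg.injective.ne_iff, hg.injective.ne_iff]
    constructor
    · rintro ⟨i, f', hf, rfl, rfl⟩
      obtain ⟨⟨h1, h2⟩, h3⟩ := (h₆ i f').1 (Or.inl hf)
      exact ⟨by omega, (key i h1 h2).1 h3⟩
    · rintro ⟨⟨h1, h2⟩, h3⟩
      obtain ⟨i, rfl⟩ := Nat.exists_eq_add_of_le h1.le
      have := (h₆ i f).2 ⟨by omega, (key i (by omega) (by omega)).2 h3⟩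
      exact ⟨i, f, by simpa using this, rfl, rfl⟩

theorem sweepAll_spec {g : SixDir → SixDir} (hg : IsRotation g) {w : List SixDir} {e : ℕ → SixDir}
    {a k : ℕ} (hk : w.length = k + 1) (hw : ∀ i ≤ k, e (a + i) = g (w.getD i .xp))
    {s r : SideTurn} (hr : r ∈ sweepAll w s) : Sweep e a (a + k) (s.map g) (r.map g) := by
  simp only [sweepAll, List.mem_flatMap, List.mem_append, Option.mem_toList] at hr
  obtain ⟨U, -, hr | hr⟩ := hr <;> exact sweepBy_spec hg hk hw hr

/-! ### Pairs of sides from one of which the tube can be swept -/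

/-- When the tube goes in direction `p` and then in direction `d`, the list `Q` contains a pair
of sides such that a sweep of the rest of the tube can start from one of them. -/
def IsGoodPair (p d : SixDir) (Q : List SideTurn) : Prop :=
  ∃ g, IsRotation g ∧ g .xp = d ∧
    ((g .xp = p ∧ ∃ P ∈ straightPairs, Q = P.map (SideTurn.map g)) ∨
      (g .zp = p ∧ ∃ P ∈ bendPairs, Q = P.map (SideTurn.map g)))

/-- The hypothesis `d ≠ p.opp` makes `d` and `p` orthogonal in the bend case, so that `frame d p` is
a rotation. -/
theorem containsPair.exists_isGoodPair {p d : SixDir} {T : List SideTurn} (hT : containsPair p d T)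
    (hpd : d ≠ p.opp) : ∃ Q, IsGoodPair p d Q ∧ ∀ s ∈ Q, s ∈ T := by
  unfold containsPair at hT
  split_ifs at hT with h
  · obtain ⟨c, -, hc, P, hP, hPT⟩ := hT
    refine ⟨P.map (SideTurn.map (frame d c)), ⟨_, isRotation_frame hc, rfl,
      Or.inl ⟨h.symm, P, hP, rfl⟩⟩, ?_⟩
    intro s hs
    obtain ⟨s₁, hs₁, rfl⟩ := List.mem_map.1 hs
    exact hPT s₁ hs₁
  · obtain ⟨P, hP, hPT⟩ := hT
    refine ⟨P.map (SideTurn.map (frame d p)), ⟨_, isRotation_frame ?_, rfl,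
      Or.inr ⟨rfl, P, hP, rfl⟩⟩, ?_⟩
    · exact left_ne_of_ne (Ne.symm h) hpd
    · intro s hs
      obtain ⟨s₁, hs₁, rfl⟩ := List.mem_map.1 hs
      exact hPT s₁ hs₁

theorem IsGoodPair.map {g : SixDir → SixDir} (hg : IsRotation g) {p d : SixDir}
    {Q : List SideTurn} (h : IsGoodPair p d Q) :
    IsGoodPair (g p) (g d) (Q.map (SideTurn.map g)) := by
  obtain ⟨g', hg', rfl, ⟨rfl, P, hP, rfl⟩ | ⟨rfl, P, hP, rfl⟩⟩ := h
  · exact ⟨g ∘ g', hg.comp hg', rfl, Or.inl ⟨rfl, P, hP, by simp [SideTurn.map]⟩⟩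
  · exact ⟨g ∘ g', hg.comp hg', rfl, Or.inr ⟨rfl, P, hP, by simp [SideTurn.map]⟩⟩

/-- The whole case analysis over the shapes of the tube is contained in this computation and the
next one. -/
theorem pairsRecur_straight : ∀ P ∈ straightPairs, pairsRecur 6 [([.xp], P)] .xp .xp = true := by
  decide +kernel

theorem pairsRecur_bend : ∀ P ∈ bendPairs, pairsRecur 6 [([.xp], P)] .zp .xp = true := by
  decide +kernel

/-- Soundness of the search: `g` carries the normalized picture to the tube, and the actual next
direction selects the branch followed. An entry of `W` holds sides of an earlier box `c` already
reached from `P`, and its word lists the directions from box `c` to box `b`. -/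
theorem pairsRecur_spec {g : SixDir → SixDir} (hg : IsRotation g) {e : ℕ → SixDir} {N a : ℕ}
    (he₁ : ∀ j, e (j + 1) ≠ (e j).opp) (he₂ : ∀ j, e (j + 2) ≠ (e j).opp) (hN : e (N + 1) = e N)
    (P : List SideTurn) (m : ℕ) :
    ∀ (W : List (List SixDir × List SideTurn)) (p d : SixDir) (b : ℕ),
      pairsRecur m W p d = true → e b = g d → e (b + 1) ≠ g p.opp → a ≤ b → b ≤ N →
      (∀ q ∈ W, ∃ c k, b = c + k ∧ a ≤ c ∧ q.1.length = k + 1 ∧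
        (∀ i ≤ k, e (c + i) = g (q.1.getD i .xp)) ∧
        ∀ s ∈ q.2, ∃ s₀ ∈ P, Sweep e a c s₀ (s.map g)) →
      (∃ s₀ ∈ P, ∃ s, Sweep e a (N + 1) s₀ s) ∨
      ∃ b' Q, b < b' ∧ b' ≤ N ∧ IsGoodPair (e (b' - 1)) (e b') Q ∧
        ∀ s ∈ Q, ∃ s₀ ∈ P, Sweep e a b' s₀ s := by
  induction m with
  | zero => intro W p d b h; simp [pairsRecur] at h
  | succ m ih =>
    intro W p d b h hb hp hab hbN hW
    obtain ⟨c, hc⟩ := hg.surjective (e (b + 1))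
    rw [pairsRecur, List.all_eq_true] at h
    have h := h c (SixDir.mem_all c)
    have hcd : c ≠ d.opp := fun h' => he₁ b (by rw [← hc, hb, h', hg.map_opp])
    have hcp : c ≠ p.opp := fun h' => hp (by rw [← hc, h'])
    simp only [hcd, hcp, decide_false, Bool.false_or, Bool.and_eq_true, Bool.or_eq_true,
      decide_eq_true_eq] at h
    obtain ⟨h₁, h₂⟩ := h
    set W' := W.map fun q => (q.1 ++ [c], q.2) with hW'
    set T := sweepFrom W' with hT
    have hWW : ∀ q ∈ W', ∃ c k, b + 1 = c + (k + 1) ∧ a ≤ c ∧ q.1.length = k + 1 + 1 ∧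
        (∀ i ≤ k + 1, e (c + i) = g (q.1.getD i .xp)) ∧
        ∀ s ∈ q.2, ∃ s₀ ∈ P, Sweep e a c s₀ (s.map g) := by
      intro q hq
      obtain ⟨q₀, hq₀, rfl⟩ := List.mem_map.1 hq
      obtain ⟨c', k, rfl, hac, hlen, hw, hs⟩ := hW q₀ hq₀
      refine ⟨c', k, rfl, hac, by simp [hlen], ?_, hs⟩
      intro i hi
      rcases Nat.lt_or_ge i (k + 1) with hik | hik
      · rw [hw i (by omega)]
        simp [List.getD_eq_getElem?_getD, List.getElem?_append_left (hlen ▸ hik)]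
      · obtain rfl : i = k + 1 := le_antisymm hi hik
        rw [← add_assoc, ← hc]
        simp [List.getD_eq_getElem?_getD, ← hlen]
    have hTT : ∀ s ∈ T, ∃ s₀ ∈ P, Sweep e a (b + 1) s₀ (s.map g) := by
      intro s hs
      simp only [hT, sweepFrom, List.mem_flatMap] at hs
      obtain ⟨q, hq, s₁, hs₁, hs⟩ := hs
      obtain ⟨c', k, hbk, hac, hlen, hw, hs'⟩ := hWW q hq
      obtain ⟨s₀, hs₀, hsw⟩ := hs' s₁ hs₁
      rw [hbk]
      exact ⟨s₀, hs₀, hsw.trans hac (by omega) (sweepAll_spec hg hlen hw hs)⟩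
    rcases hbN.lt_or_eq with hlt | rfl
    · rcases h₂ with h₂ | h₂
      · obtain ⟨Q, hQ, hQT⟩ := h₂.exists_isGoodPair hcd
        refine Or.inr ⟨b + 1, Q.map (SideTurn.map g), Nat.lt_succ_self b, hlt, ?_, ?_⟩
        · rw [← hc, Nat.add_sub_cancel, hb]; exact hQ.map hg
        · intro s hs
          obtain ⟨s₁, hs₁, rfl⟩ := List.mem_map.1 hs
          exact hTT s₁ (hQT s₁ hs₁)
      · have hW₂ : ∀ q ∈ (([c], T) :: W').take 3, ∃ c k, b + 1 = c + k ∧ a ≤ c ∧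
            q.1.length = k + 1 ∧ (∀ i ≤ k, e (c + i) = g (q.1.getD i .xp)) ∧
            ∀ s ∈ q.2, ∃ s₀ ∈ P, Sweep e a c s₀ (s.map g) := by
          intro q hq
          rcases List.mem_cons.1 (List.mem_of_mem_take hq) with rfl | hq
          · refine ⟨b + 1, 0, rfl, by omega, rfl, ?_, hTT⟩
            intro i hi
            obtain rfl : i = 0 := by omega
            simp [hc]
          · obtain ⟨c', k, h⟩ := hWW q hq
            exact ⟨c', k + 1, h⟩
        rcases ih _ d c (b + 1) h₂ hc.symm
          (by rw [hg.map_opp, ← hb]; exact he₂ b) (by omega) hlt hW₂ with h | ⟨b', Q, hb', h⟩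
        · exact Or.inl h
        · exact Or.inr ⟨b', Q, by omega, h⟩
    -- Here `b = N`: the next step is the fictitious straight one, for which the search guarantees a
    -- nonempty list of results.
    · left
      have : c = d := hg.injective (by rw [hc, hN, hb])
      simp only [this, decide_true, Bool.not_true, Bool.not_eq_true',
        List.isEmpty_eq_false_iff] at h₁
      obtain ⟨s, hs⟩ := List.exists_mem_of_ne_nil _ (h₁.resolve_left Bool.false_ne_true)
      obtain ⟨s₀, hs₀, h⟩ := hTT s hs
      exact ⟨s₀, hs₀, _, h⟩

/-- Induction on the remaining length. The later pair has a member from which the rest can be swept,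
and that member is reached from some member of `P`, whichever one it is. -/
theorem IsGoodPair.exists_sweep {e : ℕ → SixDir} {N : ℕ}
    (he₁ : ∀ j, e (j + 1) ≠ (e j).opp) (he₂ : ∀ j, e (j + 2) ≠ (e j).opp) (hN : e (N + 1) = e N)
    {a : ℕ} (ha : a ≤ N) {p : SixDir} (hp : e (a + 1) ≠ p.opp) {P : List SideTurn}
    (hP : IsGoodPair p (e a) P) : ∃ s₀ ∈ P, ∃ s, Sweep e a (N + 1) s₀ s := by
  induction hk : N - a using Nat.strong_induction_on generalizing a p P with
  | _ k ih =>
    obtain ⟨g, hg, hga, hP⟩ := hP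
    have hrec : (∃ s₀ ∈ P, ∃ s, Sweep e a (N + 1) s₀ s) ∨
        ∃ b' Q, a < b' ∧ b' ≤ N ∧ IsGoodPair (e (b' - 1)) (e b') Q ∧
        ∀ s ∈ Q, ∃ s₀ ∈ P, Sweep e a b' s₀ s := by
      rcases hP with ⟨hgp, P, hP, rfl⟩ | ⟨hgp, P, hP, rfl⟩
      · refine pairsRecur_spec hg he₁ he₂ hN _ 6 [([.xp], P)] .xp .xp a
          (pairsRecur_straight P hP) hga.symm (by rwa [hg.map_opp, hgp]) le_rfl ha ?_
        simp only [List.mem_singleton, forall_eq]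
        refine ⟨a, 0, rfl, le_rfl, rfl, ?_, fun s hs => ⟨_, List.mem_map_of_mem hs, Sweep.refl ..⟩⟩
        intro i hi
        obtain rfl : i = 0 := by omega
        simp [hga]
      · refine pairsRecur_spec hg he₁ he₂ hN _ 6 [([.xp], P)] .zp .xp a
          (pairsRecur_bend P hP) hga.symm (by rwa [hg.map_opp, hgp]) le_rfl ha ?_
        simp only [List.mem_singleton, forall_eq]
        refine ⟨a, 0, rfl, le_rfl, rfl, ?_, fun s hs => ⟨_, List.mem_map_of_mem hs, Sweep.refl ..⟩⟩
        intro i hi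
        obtain rfl : i = 0 := by omega
        simp [hga]
    rcases hrec with h | ⟨b, Q, hab, hbN, hQ, hQP⟩
    · exact h
    · obtain ⟨s₁, hs₁, s, hs⟩ := ih (N - b) (by omega) hbN
        (by
          have := he₂ (b - 1)
          rwa [show b - 1 + 2 = b + 1 by omega] at this) hQ rfl
      obtain ⟨s₀, hs₀, h⟩ := hQP s₁ hs₁
      exact ⟨s₀, hs₀, s, h.trans hab.le (by omega) hs⟩

/-! ### Boxes and their faces in terms of signed coordinates -/

namespace Dir

theorem opp_opp (d : Dir) : d.opp.opp = d := by simp [opp]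

theorem opp_axis (d : Dir) : d.opp.axis = d.axis := rfl

theorem eq_or_eq_opp {c d : Dir} (h : c.axis = d.axis) : c = d ∨ c = d.opp := by
  obtain ⟨a, s⟩ := c
  obtain ⟨b, t⟩ := d
  obtain rfl : a = b := h
  rcases Int.units_eq_one_or s with rfl | rfl <;> rcases Int.units_eq_one_or t with rfl | rfl <;>
    simp [opp]

theorem opp_ne (d : Dir) : d.opp ≠ d := by
  intro h
  have h2 := congrArg Dir.sign h
  rcases Int.units_eq_one_or d.sign with h3 | h3 <;> simp [opp, h3] at h2

/-- The signed coordinate of a point in direction `d`. -/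
def coord (d : Dir) (x : EuclideanSpace ℝ (Fin 3)) : ℝ := ((d.sign : ℤ) : ℝ) * x d.axis

theorem coord_opp (d : Dir) (x : EuclideanSpace ℝ (Fin 3)) : d.opp.coord x = -d.coord x := by
  simp [coord, opp]

/-- The largest signed coordinate, in direction `d`, of the points of a box. -/
def extent (d : Dir) (B : BoxIntegral.Box (Fin 3)) : ℝ := ((d.sign : ℤ) : ℝ) * side B d

theorem neg_extent_opp_lt (d : Dir) (B : BoxIntegral.Box (Fin 3)) :
    -d.opp.extent B < d.extent B := by
  obtain ⟨a, s⟩ := d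
  have := B.lower_lt_upper a
  rcases Int.units_eq_one_or s with rfl | rfl <;> simp [extent, opp, side]

end Dir

theorem mem_closedBox_iff {B : BoxIntegral.Box (Fin 3)} {x : EuclideanSpace ℝ (Fin 3)} :
    x ∈ closedBox B ↔ ∀ d : Dir, d.coord x ≤ d.extent B := by
  constructor
  · rintro h ⟨a, s⟩
    have := h a
    rcases Int.units_eq_one_or s with rfl | rfl <;> simp [Dir.coord, Dir.extent, side] <;> tauto
  · intro h a
    have h₁ := h ⟨a, 1⟩
    have h₂ := h ⟨a, -1⟩
    simp [Dir.coord, Dir.extent, side] at h₁ h₂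
    exact ⟨h₂, h₁⟩

theorem mem_boxFace_iff {B : BoxIntegral.Box (Fin 3)} {d : Dir} {x : EuclideanSpace ℝ (Fin 3)} :
    x ∈ boxFace B d ↔ x ∈ closedBox B ∧ d.coord x = d.extent B := by
  have : d.coord x = d.extent B ↔ x d.axis = side B d := by
    rw [Dir.coord, Dir.extent]
    refine mul_right_inj' ?_
    rcases Int.units_eq_one_or d.sign with h | h <;> simp [h]
  rw [this]; rfl

theorem exists_mem_boxFace (B : BoxIntegral.Box (Fin 3)) {c d : Dir} (h : c.axis ≠ d.axis) :
    ∃ x ∈ boxFace B d, c.coord x = c.extent B := by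
  refine ⟨WithLp.toLp 2 fun a => if a = d.axis then side B d else if a = c.axis then side B c else
    B.lower a, ⟨?_, by simp⟩, by simp [Dir.coord, Dir.extent, h]⟩
  intro a
  have hB := (B.lower_lt_upper a).le
  have hs : ∀ e : Dir, B.lower e.axis ≤ side B e ∧ side B e ≤ B.upper e.axis := by
    intro e
    have := (B.lower_lt_upper e.axis).le
    unfold side
    split_ifs <;> simp [this]
  simp only
  split_ifs with h₁ h₂
  · rw [h₁]; exact hs d
  · rw [h₂]; exact hs c
  · exact ⟨le_rfl, hB⟩

/-- `B` and `B'` are glued along the face of `B` with outward normal `d`. -/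
structure GluedBoxes (B B' : BoxIntegral.Box (Fin 3)) (d : Dir) : Prop where
  extent_opp : d.opp.extent B' = -d.extent B
  extent_eq : ∀ c : Dir, c.axis ≠ d.axis → c.extent B' = c.extent B

/-- Every extent transverse to `d` is attained at a point of the face, so equal faces force equal
extents. -/
theorem gluedBoxes_of_boxFace_eq {B B' : BoxIntegral.Box (Fin 3)} {d : Dir}
    (h : boxFace B d = boxFace B' d.opp) : GluedBoxes B B' d := by
  refine ⟨?_, fun c hc => le_antisymm ?_ ?_⟩
  · obtain ⟨c, hc⟩ : ∃ c : Dir, c.axis ≠ d.axis := ⟨⟨d.axis + 1, 1⟩, by simp⟩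
    obtain ⟨x, hx, -⟩ := exists_mem_boxFace B hc
    rw [← (mem_boxFace_iff.1 hx).2, ← (mem_boxFace_iff.1 (h ▸ hx)).2, Dir.coord_opp]
  · obtain ⟨x, hx, hcx⟩ := exists_mem_boxFace B' (c := c) (d := d.opp) hc
    rw [← hcx]
    exact mem_closedBox_iff.1 (mem_boxFace_iff.1 (h ▸ hx)).1 c
  · obtain ⟨x, hx, hcx⟩ := exists_mem_boxFace B hc
    rw [← hcx]
    exact mem_closedBox_iff.1 (mem_boxFace_iff.1 (h ▸ hx)).1 c

theorem GluedBoxes.symm {B B' : BoxIntegral.Box (Fin 3)} {d : Dir} (h : GluedBoxes B B' d) :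
    GluedBoxes B' B d.opp :=
  ⟨by rw [Dir.opp_opp, h.extent_opp, neg_neg], fun c hc => (h.extent_eq c hc).symm⟩

theorem GluedBoxes.unique {B B' : BoxIntegral.Box (Fin 3)} {c d : Dir} (hc : GluedBoxes B B' c)
    (hd : GluedBoxes B B' d) : c = d := by
  by_cases h : c.axis = d.axis
  · rcases Dir.eq_or_eq_opp h with rfl | rfl
    · rfl
    · have h₁ := hc.extent_opp
      have h₂ := hd.extent_opp
      rw [Dir.opp_opp] at h₁
      have h₃ := Dir.neg_extent_opp_lt d B
      have h₄ := Dir.neg_extent_opp_lt d B'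
      linarith
  · have h₁ := hd.extent_eq c.opp h
    have h₂ := hc.extent_opp
    have h₃ := Dir.neg_extent_opp_lt c B
    linarith

/-- The intersection is a box that is nondegenerate along `a` and `b`. Its lowest corner and the two
points obtained by moving that corner along these axes are not collinear. -/
theorem not_collinear_of_extent {B B' : BoxIntegral.Box (Fin 3)}
    (h : ∀ d : Dir, -d.opp.extent B' ≤ d.extent B) {a b : Fin 3} (hab : a ≠ b)
    (hlt : ∀ d : Dir, d.axis = a ∨ d.axis = b → -d.opp.extent B' < d.extent B) :
    ¬ Collinear ℝ (closedBox B ∩ closedBox B') := by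
  set l : Fin 3 → ℝ := fun i => max (B.lower i) (B'.lower i) with hl
  set u : Fin 3 → ℝ := fun i => min (B.upper i) (B'.upper i) with hu
  have hle : ∀ i, l i ≤ u i := by
    intro i
    have h₁ := h ⟨i, 1⟩
    have h₂ := h ⟨i, -1⟩
    simp [Dir.extent, Dir.opp, side] at h₁ h₂
    simp [hl, hu, h₁, h₂, (B.lower_lt_upper i).le, (B'.lower_lt_upper i).le]
  have hlt' : ∀ i, i = a ∨ i = b → l i < u i := by
    intro i hi
    have h₁ := hlt ⟨i, 1⟩ hi
    have h₂ := hlt ⟨i, -1⟩ hi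
    simp [Dir.extent, Dir.opp, side] at h₁ h₂
    simp [hl, hu, h₁, h₂, (B.lower_lt_upper i), (B'.lower_lt_upper i)]
  have hmem : ∀ x : Fin 3 → ℝ, (∀ i, l i ≤ x i ∧ x i ≤ u i) →
      WithLp.toLp 2 x ∈ closedBox B ∩ closedBox B' := by
    intro x hx
    simp only [hl, hu, le_min_iff, max_le_iff] at hx
    exact ⟨fun i => ⟨(hx i).1.1, (hx i).2.1⟩, fun i => ⟨(hx i).1.2, (hx i).2.2⟩⟩
  have hp₀ := hmem l fun i => ⟨le_rfl, hle i⟩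
  have hupd : ∀ c, WithLp.toLp 2 (Function.update l c (u c)) ∈ closedBox B ∩ closedBox B' := by
    intro c
    refine hmem _ fun i => ?_
    by_cases hi : i = c
    · subst hi; simp [hle i]
    · simp [hi, hle i]
  intro hcol
  obtain ⟨v, hv⟩ := (collinear_iff_of_mem hp₀).1 hcol
  obtain ⟨r, hr⟩ := hv _ (hupd a)
  obtain ⟨s, hs⟩ := hv _ (hupd b)
  have hra := congrArg (fun x : EuclideanSpace ℝ (Fin 3) => x a) hr
  have hrb := congrArg (fun x : EuclideanSpace ℝ (Fin 3) => x b) hr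
  have hsb := congrArg (fun x : EuclideanSpace ℝ (Fin 3) => x b) hs
  simp [hab.symm] at hra hrb hsb
  have h₁ := hlt' a (Or.inl rfl)
  have h₂ := hlt' b (Or.inr rfl)
  rcases hrb with hrb | hrb
  · rw [hrb, zero_mul, zero_add] at hra; linarith
  · rw [hrb, mul_zero, zero_add] at hsb; linarith

namespace SixDir

/-- The signed axis direction named by an element of the enumeration. -/
def toDir : SixDir → Dir
  | xp => ⟨0, 1⟩ | xm => ⟨0, -1⟩ | yp => ⟨1, 1⟩ | ym => ⟨1, -1⟩ | zp => ⟨2, 1⟩ | zm => ⟨2, -1⟩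

theorem toDir_opp (a : SixDir) : a.opp.toDir = a.toDir.opp := by cases a <;> rfl

theorem toDir_injective : Function.Injective toDir := by decide

theorem toDir_surjective : Function.Surjective toDir := by
  rintro ⟨a, s⟩
  rcases Int.units_eq_one_or s with rfl | rfl <;> fin_cases a
  exacts [⟨xp, rfl⟩, ⟨yp, rfl⟩, ⟨zp, rfl⟩, ⟨xm, rfl⟩, ⟨ym, rfl⟩, ⟨zm, rfl⟩]

theorem vec_left {n d : SixDir} (h : n.toDir.axis ≠ d.toDir.axis) :
    (left n d).toDir.vec = crossProduct n.toDir.vec d.toDir.vec := by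
  revert n d
  decide +kernel

end SixDir

/-! ### The sequence of gluing directions of an orthotube. -/

namespace Orthotube

variable {n : ℕ} (T : Orthotube n)

theorem Glued.gluedBoxes {T : Orthotube n} {i j : Fin (n + 1)} {d : Dir} (h : T.Glued i d j) :
    GluedBoxes (T.box i) (T.box j) d :=
  gluedBoxes_of_boxFace_eq h.2

/-- After an immediate reversal the boxes `i` and `k` agree on all sides except possibly the one
towards `c.opp`, so they overlap in a solid box. -/
theorem ne_opp_of_gluedBoxes {i j k : Fin (n + 1)} (hij : i.val + 1 = j.val)
    (hjk : j.val + 1 = k.val) {c d : Dir} (hc : GluedBoxes (T.box i) (T.box j) c)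
    (hd : GluedBoxes (T.box j) (T.box k) d) : d ≠ c.opp := by
  rintro rfl
  have h₁ : ∀ e : Dir, e ≠ c.opp → e.extent (T.box k) = e.extent (T.box i) := by
    intro e he
    by_cases hec : e.axis = c.axis
    · obtain rfl := (Dir.eq_or_eq_opp hec).resolve_right he
      have := hd.extent_opp
      rw [Dir.opp_opp] at this
      rw [this, hc.extent_opp, neg_neg]
    · rw [hd.extent_eq e hec, hc.extent_eq e hec]
  have h₂ : ∀ e : Dir, -e.opp.extent (T.box k) < e.extent (T.box i) := by
    intro e
    by_cases he : e = c.opp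
    · subst he
      have := h₁ c (Dir.opp_ne c).symm
      rw [Dir.opp_opp, this]
      have := Dir.neg_extent_opp_lt c (T.box i)
      linarith
    · rw [← h₁ e he]
      exact Dir.neg_extent_opp_lt e _
  exact not_collinear_of_extent (fun e => (h₂ e).le) (a := 0) (b := 1) (by decide)
    (fun e _ => h₂ e) (T.apart i k (by omega))

/-- Directions `c`, `d`, `c.opp` make a U-turn that puts box `l` against the `d`-side of box `i`.
They are aligned on their `c`-side and in the third axis, so they share a rectangle. -/
theorem ne_opp_of_gluedBoxes₂ {i j k l : Fin (n + 1)} (hij : i.val + 1 = j.val)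
    (hjk : j.val + 1 = k.val) (hkl : k.val + 1 = l.val) {c d e : Dir}
    (hc : GluedBoxes (T.box i) (T.box j) c) (hd : GluedBoxes (T.box j) (T.box k) d)
    (he : GluedBoxes (T.box k) (T.box l) e) : e ≠ c.opp := by
  rintro rfl
  have hdc := T.ne_opp_of_gluedBoxes hij hjk hc hd
  have hcd := T.ne_opp_of_gluedBoxes hjk hkl hd he
  have hax : c.axis ≠ d.axis := fun h => (Dir.eq_or_eq_opp h.symm).elim (fun h' => hcd (by rw [h']))
    hdc
  have e₁ : c.extent (T.box l) = c.extent (T.box i) := by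
    have := he.extent_opp
    rw [Dir.opp_opp] at this
    rw [this, hd.extent_eq c.opp hax, hc.extent_opp, neg_neg]
  have e₂ : ∀ a : Dir, a.axis ≠ c.axis → a.axis ≠ d.axis →
      a.extent (T.box l) = a.extent (T.box i) := fun a h₁ h₂ => by
    rw [he.extent_eq a h₁, hd.extent_eq a h₂, hc.extent_eq a h₁]
  have e₃ : d.opp.extent (T.box l) = -d.extent (T.box i) := by
    rw [he.extent_eq d.opp hax.symm, hd.extent_opp, hc.extent_eq d hax.symm]
  have hlt : ∀ a : Dir, a.axis ≠ d.axis → -a.opp.extent (T.box l) < a.extent (T.box i) := by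
    intro a ha
    by_cases hac : a.axis = c.axis
    · rcases Dir.eq_or_eq_opp hac with rfl | rfl
      · rw [← e₁]; exact Dir.neg_extent_opp_lt _ _
      · rw [Dir.opp_opp, e₁]
        have := Dir.neg_extent_opp_lt c (T.box i)
        linarith
    · rw [e₂ a.opp hac ha]; exact Dir.neg_extent_opp_lt _ _
  obtain ⟨b, hbc, hbd⟩ : ∃ b, b ≠ c.axis ∧ b ≠ d.axis := by
    generalize c.axis = x, d.axis = y
    revert x y; decide
  refine not_collinear_of_extent (fun a => ?_) (a := c.axis) (b := b) hbc.symm (fun a ha => hlt a ?_)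
    (T.apart i l (by omega))
  · by_cases had : a.axis = d.axis
    · rcases Dir.eq_or_eq_opp had with rfl | rfl
      · rw [e₃, neg_neg]
      · rw [Dir.opp_opp]
        have h₁ := Dir.neg_extent_opp_lt d (T.box l)
        have h₂ := Dir.neg_extent_opp_lt d (T.box i)
        linarith
    · exact (hlt a had).le
  · rcases ha with ha | ha
    · rwa [ha]
    · rwa [ha]

/-- The directions in which the boxes of an orthotube are glued to each other, continued by one
straight step at either end. -/
theorem exists_directions : ∃ e : ℕ → SixDir,
    (∀ j, e (j + 1) ≠ (e j).opp) ∧ (∀ j, e (j + 2) ≠ (e j).opp) ∧ e 1 = e 0 ∧ e (n + 1) = e n ∧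
    ∀ (i j : Fin (n + 1)) (d : SixDir), T.Glued i d.toDir j ↔
      (i.val + 1 = j.val ∧ d = e (i + 1)) ∨ (j.val + 1 = i.val ∧ d = (e i).opp) := by
  rcases n.eq_zero_or_pos with rfl | hn
  · refine ⟨fun _ => .xp, fun _ => (SixDir.opp_ne _).symm, fun _ => (SixDir.opp_ne _).symm, rfl, rfl,
      fun i j d => ?_⟩
    have := i.2
    have := j.2
    simp only [Glued]
    omega
  have hex : ∀ i : Fin n, ∃ d : SixDir,
      boxFace (T.box i.castSucc) d.toDir = boxFace (T.box i.succ) d.toDir.opp := by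
    intro i
    obtain ⟨d, hd⟩ := T.glued i
    obtain ⟨d, rfl⟩ := SixDir.toDir_surjective d
    exact ⟨d, hd⟩
  choose δ hδ using hex
  have hg : ∀ i : Fin n, GluedBoxes (T.box i.castSucc) (T.box i.succ) (δ i).toDir :=
    fun i => gluedBoxes_of_boxFace_eq (hδ i)
  -- Boxes of the model are numbered from 1, hence `j - 1`. The clamping repeats the first and the
  -- last direction, which gives the fictitious straight steps.
  set e : ℕ → SixDir := fun j => δ ⟨min (j - 1) (n - 1), by omega⟩ with he
  have heδ : ∀ i : Fin n, e (i + 1) = δ i := by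
    intro i
    have := i.2
    simp only [he]
    congr 1
    ext
    simp only [Nat.add_sub_cancel]
    omega
  have h₁ : ∀ i j : Fin n, i.val + 1 = j.val → δ j ≠ (δ i).opp := by
    intro i j hij h
    have hs : i.succ = j.castSucc := Fin.ext hij
    refine T.ne_opp_of_gluedBoxes (i := i.castSucc) (j := i.succ) (k := j.succ) rfl
      (by simp [hij]) (hg i) (hs ▸ hg j) ?_
    rw [h, SixDir.toDir_opp]
  have h₂ : ∀ i j : Fin n, i.val + 2 = j.val → δ j ≠ (δ i).opp := by
    intro i j hij h
    obtain ⟨k, hk⟩ : ∃ k : Fin n, k.val = i.val + 1 := ⟨⟨i + 1, by omega⟩, rfl⟩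
    have hs : i.succ = k.castSucc := Fin.ext hk.symm
    have hs' : k.succ = j.castSucc := Fin.ext (by simp; omega)
    refine T.ne_opp_of_gluedBoxes₂ (i := i.castSucc) (j := i.succ) (k := k.succ) (l := j.succ) rfl
      (by simp [hk]) (by simp; omega) (hg i) (hs ▸ hg k) (hs' ▸ hg j) ?_
    rw [h, SixDir.toDir_opp]
  refine ⟨e, ?_, ?_, ?_, ?_, ?_⟩
  · intro j
    simp only [he]
    rcases Nat.eq_or_lt_of_le (show min (j - 1) (n - 1) ≤ min (j + 1 - 1) (n - 1) by omega)
      with h | h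
    · simp only [h]; exact (SixDir.opp_ne _).symm
    · exact h₁ _ _ (by simp only; omega)
  · intro j
    simp only [he]
    rcases Nat.eq_or_lt_of_le (show min (j - 1) (n - 1) ≤ min (j + 2 - 1) (n - 1) by omega)
      with h | h
    · simp only [h]; exact (SixDir.opp_ne _).symm
    · rcases Nat.eq_or_lt_of_le (Nat.succ_le_of_lt h) with h | h
      · exact h₁ _ _ (by simp only; omega)
      · exact h₂ _ _ (by simp only; omega)
  · rfl
  · simp only [he]
    congr 1
    ext
    simp only
    omega
  · have hfwd : ∀ i j : Fin (n + 1), i.val + 1 = j.val →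
        ∃ k : Fin n, i = k.castSucc ∧ j = k.succ ∧ e (i + 1) = δ k := by
      intro i j hij
      have := j.2
      refine ⟨⟨i, by omega⟩, rfl, Fin.ext (by simp [hij]), heδ ⟨i, by omega⟩⟩
    intro i j d
    constructor
    · intro h
      rcases h.1 with hij | hij
      · obtain ⟨k, rfl, rfl, hk⟩ := hfwd i j hij
        exact Or.inl ⟨hij, by rw [hk]; exact SixDir.toDir_injective (h.gluedBoxes.unique (hg k))⟩
      · obtain ⟨k, rfl, rfl, hk⟩ := hfwd j i hij
        refine Or.inr ⟨hij, SixDir.toDir_injective ?_⟩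
        rw [← hij, hk, SixDir.toDir_opp]
        exact h.gluedBoxes.unique (hg k).symm
    · rintro (⟨hij, rfl⟩ | ⟨hij, rfl⟩)
      · obtain ⟨k, rfl, rfl, hk⟩ := hfwd i j hij
        exact ⟨Or.inl hij, hk ▸ hδ k⟩
      · obtain ⟨k, rfl, rfl, hk⟩ := hfwd j i hij
        refine ⟨Or.inr hij, ?_⟩
        rw [← hij, hk, SixDir.toDir_opp, Dir.opp_opp, hδ k]

end Orthotube

/-! ### Staircases of rectangles in the plane -/

theorem Turn.quarter_add {h t h' : Turn} (ht : h.add t = some h') :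
    h'.quarter = h.quarter + t.quarter := by
  cases h <;> cases t <;> simp [Turn.add] at ht <;> subst ht <;> rfl

theorem quarter_foldlM {U : ChainCode} {h h' : Turn} (hU : U.foldlM Turn.add h = some h') :
    h'.quarter = h.quarter + quarterTurning U := by
  induction U generalizing h with
  | nil => simp at hU; simp [quarterTurning, hU]
  | cons t U ih =>
    simp only [List.foldlM_cons, Option.bind_eq_bind, Option.bind_eq_some_iff] at hU
    obtain ⟨h₁, ht, hU⟩ := hU
    have := ih hU
    rw [this, Turn.quarter_add ht]
    simp [quarterTurning, add_assoc]

theorem quarterTurning_mem_of_foldlM {U P : ChainCode} {h : Turn}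
    (hU : U.foldlM Turn.add .S = some h) (hP : P <+: U) :
    quarterTurning P ∈ ({-1, 0, 1} : Set ℤ) := by
  obtain ⟨V, rfl⟩ := hP
  simp only [List.foldlM_append, Option.bind_eq_bind, Option.bind_eq_some_iff] at hU
  obtain ⟨h₁, hP, -⟩ := hU
  have := quarter_foldlM hP
  rw [show Turn.S.quarter = 0 from rfl, zero_add] at this
  rw [← this]
  cases h₁ <;> simp [Turn.quarter]

/-- An axis-parallel rectangle in the plane. -/
structure PlaneRect where
  left : ℝ
  right : ℝ
  bottom : ℝ
  top : ℝ
  left_le : left ≤ right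
  bottom_le : bottom ≤ top

/-- `Q'` is attached to `Q` along a full edge: above `Q` for `S`, to the right of `Q` for `R`, to
the left of `Q` for `L`. -/
def Turn.Beside : Turn → PlaneRect → PlaneRect → Prop
  | .S, Q, Q' => Q'.bottom = Q.top ∧ Q'.left = Q.left ∧ Q'.right = Q.right
  | .R, Q, Q' => Q'.left = Q.right ∧ Q'.bottom = Q.bottom ∧ Q'.top = Q.top
  | .L, Q, Q' => Q'.right = Q.left ∧ Q'.bottom = Q.bottom ∧ Q'.top = Q.top

/-- Rectangles, each beside the previous one, which never go down, nor immediately from left to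
right or from right to left.  The first rectangle, `Q`, was reached with heading `h`. -/
inductive Staircase : Turn → PlaneRect → List PlaneRect → Prop
  | nil (h : Turn) (Q : PlaneRect) : Staircase h Q []
  | cons {h t h' : Turn} {Q Q' : PlaneRect} {l : List PlaneRect} (ht : h.add t = some h')
      (hQ : h'.Beside Q Q') (hl : Staircase h' Q' l) : Staircase h Q (Q' :: l)

/-- A horizontal or vertical line separates the two rectangles. -/
def PlaneRect.Separated (Q Q' : PlaneRect) : Prop :=
  Q.top ≤ Q'.bottom ∨ Q.right ≤ Q'.left ∨ Q'.right ≤ Q.left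

/-- The heading is part of the invariant: a staircase that has just moved left cannot pass to the
right of `Q` before rising above it, and symmetrically. -/
theorem Staircase.forall_mem {h : Turn} {Q : PlaneRect} {l : List PlaneRect}
    (hl : Staircase h Q l) : ∀ Q' ∈ l, Q.bottom ≤ Q'.bottom ∧
      (Q.top ≤ Q'.bottom ∨ (h ≠ .L ∧ Q.right ≤ Q'.left) ∨ (h ≠ .R ∧ Q'.right ≤ Q.left)) := by
  induction hl with
  | nil => simp
  | @cons h t h' Q Q₁ l ht hQ hl ih =>
    -- The comparison with `Q₁.left` and `Q₁.right` is weak enough to include `Q' = Q₁`.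
    have key : ∀ Q' : PlaneRect, (Q₁.bottom ≤ Q'.bottom ∧ (Q₁.top ≤ Q'.bottom ∨
        (h' ≠ .L ∧ Q₁.left ≤ Q'.left) ∨ (h' ≠ .R ∧ Q'.right ≤ Q₁.right))) →
        Q.bottom ≤ Q'.bottom ∧
        (Q.top ≤ Q'.bottom ∨ (h ≠ .L ∧ Q.right ≤ Q'.left) ∨ (h ≠ .R ∧ Q'.right ≤ Q.left)) := by
      rintro Q' ⟨h₁, h₂⟩
      have hQb := Q.bottom_le
      cases h' with
      | S =>
        obtain ⟨e₁, e₂, e₃⟩ := hQ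
        exact ⟨by linarith, Or.inl (by linarith)⟩
      | R =>
        obtain ⟨e₁, e₂, e₃⟩ := hQ
        have hh : h ≠ .L := by rintro rfl; cases t <;> simp [Turn.add] at ht
        refine ⟨by linarith, ?_⟩
        rcases h₂ with h₂ | h₂ | h₂
        · exact Or.inl (by linarith)
        · exact Or.inr (Or.inl ⟨hh, by linarith⟩)
        · exact absurd rfl h₂.1
      | L =>
        obtain ⟨e₁, e₂, e₃⟩ := hQ
        have hh : h ≠ .R := by rintro rfl; cases t <;> simp [Turn.add] at ht
        refine ⟨by linarith, ?_⟩
        rcases h₂ with h₂ | h₂ | h₂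
        · exact Or.inl (by linarith)
        · exact absurd rfl h₂.1
        · exact Or.inr (Or.inr ⟨hh, by linarith⟩)
    intro Q' hQ'
    refine key Q' ?_
    rcases List.mem_cons.1 hQ' with rfl | hQ'
    · refine ⟨le_rfl, Or.inr ?_⟩
      cases h' <;> simp
    · obtain ⟨h₁, h₂⟩ := ih Q' hQ'
      refine ⟨h₁, h₂.imp id (Or.imp (fun h => ⟨h.1, ?_⟩) fun h => ⟨h.1, ?_⟩)⟩
      · exact Q₁.left_le.trans h.2
      · exact h.2.trans Q₁.left_le

theorem Staircase.pairwise {h : Turn} {Q : PlaneRect} {l : List PlaneRect}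
    (hl : Staircase h Q l) : (Q :: l).Pairwise PlaneRect.Separated := by
  induction hl with
  | nil => simp
  | cons ht hQ hl ih =>
    refine List.pairwise_cons.2 ⟨fun Q' hQ' => ?_, ih⟩
    exact ((Staircase.cons ht hQ hl).forall_mem Q' hQ').2.imp id (Or.imp And.right And.right)

/-! ### The unfolding by unit squares -/

/-- The unit square centered at `p`. -/
noncomputable def unitRect (p : ℤ × ℤ) : PlaneRect where
  left := p.1 - 1 / 2
  right := p.1 + 1 / 2
  bottom := p.2 - 1 / 2
  top := p.2 + 1 / 2
  left_le := by linarith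
  bottom_le := by linarith

/-- Headings as vectors. -/
def Turn.heading : Turn → ℤ × ℤ
  | .L => (-1, 0)
  | .R => (1, 0)
  | .S => (0, 1)

theorem Turn.rotate_heading {h t h' : Turn} (ht : h.add t = some h') :
    t.rotate h.heading = h'.heading := by
  cases h <;> cases t <;> simp [Turn.add] at ht <;> subst ht <;> rfl

theorem Turn.beside_unitRect (h : Turn) (p : ℤ × ℤ) :
    h.Beside (unitRect p) (unitRect (p + h.heading)) := by
  cases h <;> simp [Turn.Beside, unitRect, Turn.heading] <;> ring

theorem staircase_unfoldingDualFrom {U : ChainCode} {h h' : Turn} {p : ℤ × ℤ}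
    (hU : U.foldlM Turn.add h = some h') :
    ∃ l, unfoldingDualFrom p h.heading U = p :: l ∧
      Staircase h (unitRect p) (l.map unitRect) := by
  induction U generalizing h p with
  | nil => exact ⟨[], rfl, .nil _ _⟩
  | cons t U ih =>
    simp only [List.foldlM_cons, Option.bind_eq_bind, Option.bind_eq_some_iff] at hU
    obtain ⟨h₁, ht, hU⟩ := hU
    obtain ⟨l, hl, hs⟩ := ih (p := p + h₁.heading) hU
    exact ⟨(p + h₁.heading) :: l, by rw [unfoldingDualFrom, Turn.rotate_heading ht, hl],
      .cons ht (h₁.beside_unitRect p) hs⟩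

theorem disjoint_interior_unitSquare {p q : ℤ × ℤ} (h : (unitRect p).Separated (unitRect q)) :
    Disjoint (interior (unitSquare p)) (interior (unitSquare q)) := by
  rw [Set.disjoint_left]
  intro x hx hy
  simp only [unitSquare, interior_prod_eq, interior_Icc, Set.mem_prod, Set.mem_Ioo] at hx hy
  simp only [PlaneRect.Separated, unitRect] at h
  rcases h with h | h | h <;> linarith [hx.1.1, hx.1.2, hx.2.1, hx.2.2, hy.1.1, hy.1.2, hy.2.1,
    hy.2.2]

theorem squaresDoNotOverlap_of_foldlM {U : ChainCode} {h : Turn}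
    (hU : U.foldlM Turn.add .S = some h) : SquaresDoNotOverlap U := by
  obtain ⟨l, hl, hs⟩ := staircase_unfoldingDualFrom (p := (0, 1)) hU
  have h₁ : Staircase .S (unitRect (0, 0)) (unitRect (0, 1) :: l.map unitRect) :=
    .cons (t := .S) rfl (Turn.beside_unitRect .S (0, 0)) hs
  have h₂ := h₁.pairwise
  have h₃ : unfoldingDual U = (0, 0) :: (0, 1) :: l := congrArg (List.cons (0, 0)) hl
  rw [SquaresDoNotOverlap, h₃]
  rw [show unitRect (0, 0) :: unitRect (0, 1) :: l.map unitRect =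
    ((0, 0) :: (0, 1) :: l).map unitRect from rfl, List.pairwise_map] at h₂
  exact h₂.imp disjoint_interior_unitSquare

/-! ### Placing faces in the plane -/

theorem Dir.vec_opp (d : Dir) : d.opp.vec = -d.vec := by
  simp [Dir.vec, Dir.opp, Pi.single_neg]

theorem Dir.vec_injective : Function.Injective Dir.vec := by
  intro c d h
  obtain ⟨c, rfl⟩ := SixDir.toDir_surjective c
  obtain ⟨d, rfl⟩ := SixDir.toDir_surjective d
  revert c d
  decide +kernel

/-- Seen from outside, on a face with outward normal `ν`, the direction `r` is to the right of
the direction `u`. -/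
structure IsFrame (ν r u : Dir) : Prop where
  axis_u : u.axis ≠ ν.axis
  axis_r : r.axis ≠ ν.axis
  axis_ru : r.axis ≠ u.axis
  vec_r : r.vec = crossProduct u.vec ν.vec
  vec_u : u.vec = crossProduct ν.vec r.vec
  vec_ν : ν.vec = crossProduct r.vec u.vec

theorem exists_isFrame {ν u : Dir} (h : u.axis ≠ ν.axis) : ∃ r, IsFrame ν r u := by
  obtain ⟨n, rfl⟩ := SixDir.toDir_surjective ν
  obtain ⟨d, rfl⟩ := SixDir.toDir_surjective u
  have : ∀ n d : SixDir, d.toDir.axis ≠ n.toDir.axis →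
      (SixDir.left d n).toDir.axis ≠ n.toDir.axis ∧ (SixDir.left d n).toDir.axis ≠ d.toDir.axis ∧
      (SixDir.left d n).toDir.vec = crossProduct d.toDir.vec n.toDir.vec ∧
      d.toDir.vec = crossProduct n.toDir.vec (SixDir.left d n).toDir.vec ∧
      n.toDir.vec = crossProduct (SixDir.left d n).toDir.vec d.toDir.vec := by decide +kernel
  obtain ⟨h₁, h₂, h₃, h₄, h₅⟩ := this n d h
  exact ⟨_, h, h₁, h₂, h₃, h₄, h₅⟩

/-- The direction on a face that corresponds to a heading in the plane. -/
def Turn.dir : Turn → Dir → Dir → Dir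
  | .S, _, u => u
  | .R, r, _ => r
  | .L, r, _ => r.opp

/-- Turning on the surface and turning in the plane agree, so the accumulated turning is the heading
of the placed face. -/
theorem IsFrame.dir_of_exits {ν r u d : Dir} (hF : IsFrame ν r u) {h t h' : Turn}
    (ht : h.add t = some h') (hd : t.Exits ν (h.dir r u) d) : d = h'.dir r u := by
  cases h <;> cases t <;> simp only [Turn.add, Option.some.injEq, reduceCtorEq] at ht <;>
    subst ht <;> simp only [Turn.Exits, Turn.dir] at hd ⊢ <;>
    first
    | exact hd
    | exact Dir.vec_injective (hd.trans (by
        first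
        | exact hF.vec_r.symm
        | exact hF.vec_u.symm
        | rw [Dir.vec_opp, map_neg, LinearMap.neg_apply, cross_anticomm, ← hF.vec_u]
        | rw [Dir.vec_opp, hF.vec_r, cross_anticomm]))

/-- The frame after a convex crossing upwards; `IsFrame.right` is its sideways analogue. The reflex
crossings follow by reversing the normal and one tangent direction. -/
theorem IsFrame.up {ν r u : Dir} (hF : IsFrame ν r u) : IsFrame u r ν.opp := by
  refine ⟨hF.axis_u.symm, hF.axis_ru, hF.axis_r, ?_, ?_, ?_⟩ <;>
    simp only [Dir.vec_opp, map_neg, LinearMap.neg_apply, cross_anticomm]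
  · exact hF.vec_r
  · rw [hF.vec_ν, cross_anticomm]
  · exact hF.vec_u

theorem IsFrame.right {ν r u : Dir} (hF : IsFrame ν r u) : IsFrame r ν.opp u := by
  refine ⟨hF.axis_ru.symm, hF.axis_r.symm, hF.axis_u.symm, ?_, ?_, ?_⟩ <;>
    simp only [Dir.vec_opp, map_neg, LinearMap.neg_apply, cross_anticomm]
  · rw [hF.vec_ν, cross_anticomm]
  · exact hF.vec_u
  · exact hF.vec_r

theorem IsFrame.opp_u {ν r u : Dir} (hF : IsFrame ν r u) : IsFrame ν.opp r u.opp := by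
  refine ⟨hF.axis_u, hF.axis_r, hF.axis_ru, ?_, ?_, ?_⟩ <;>
    simp only [Dir.vec_opp, map_neg, LinearMap.neg_apply, neg_neg, neg_inj]
  exacts [hF.vec_r, hF.vec_u, hF.vec_ν]

theorem IsFrame.opp_r {ν r u : Dir} (hF : IsFrame ν r u) : IsFrame ν.opp r.opp u := by
  refine ⟨hF.axis_u, hF.axis_r, hF.axis_ru, ?_, ?_, ?_⟩ <;>
    simp only [Dir.vec_opp, map_neg, LinearMap.neg_apply, neg_neg, neg_inj]
  exacts [hF.vec_r, hF.vec_u, hF.vec_ν]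

/-- A placement of a face in the plane: the direction `r` becomes the first and the direction
`u` the second coordinate direction. -/
structure Placement where
  r : Dir
  u : Dir
  a : ℝ
  b : ℝ

namespace Placement

/-- The placement as a map. -/
noncomputable def map (P : Placement) (x : EuclideanSpace ℝ (Fin 3)) : EuclideanSpace ℝ (Fin 2) :=
  !₂[P.r.coord x + P.a, P.u.coord x + P.b]

/-- The image of a face of the box `B`. -/
noncomputable def planeRect (P : Placement) (B : BoxIntegral.Box (Fin 3)) : PlaneRect where
  left := -P.r.opp.extent B + P.a
  right := P.r.extent B + P.a
  bottom := -P.u.opp.extent B + P.b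
  top := P.u.extent B + P.b
  left_le := by linarith [P.r.neg_extent_opp_lt B]
  bottom_le := by linarith [P.u.neg_extent_opp_lt B]

/-- The normal coordinate is constant on the face, so distances depend only on the two tangential
coordinates. -/
theorem isometry_map {P : Placement} {ν : Dir} (hF : IsFrame ν P.r P.u)
    (B : BoxIntegral.Box (Fin 3)) : Isometry ((boxFace B ν).domRestrict P.map) := by
  refine Isometry.of_dist_eq fun x y => ?_
  obtain ⟨x, hx⟩ := x
  obtain ⟨y, hy⟩ := y
  have hν : x ν.axis = y ν.axis := hx.2.trans hy.2.symm
  have huniv : (Finset.univ : Finset (Fin 3)) = {P.r.axis, P.u.axis, ν.axis} := by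
    have h₁ := hF.axis_u
    have h₂ := hF.axis_r
    have h₃ := hF.axis_ru
    generalize P.r.axis = i, P.u.axis = j, ν.axis = k at h₁ h₂ h₃
    revert i j k
    decide
  have hsq : ∀ d : Dir, ∀ c : ℝ, dist (d.coord x + c) (d.coord y + c) ^ 2 =
      dist (x d.axis) (y d.axis) ^ 2 := by
    intro d c
    rcases Int.units_eq_one_or d.sign with h | h <;>
      simp [Dir.coord, h, Real.dist_eq, sq_abs]
  rw [Subtype.dist_eq, EuclideanSpace.dist_eq, EuclideanSpace.dist_eq, huniv,
    Finset.sum_insert (by simp [hF.axis_ru, hF.axis_r]), Finset.sum_insert (by simp [hF.axis_u]),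
    Finset.sum_singleton, hν, dist_self, Fin.sum_univ_two]
  simp only [Set.domRestrict, map]
  congr 1
  have h₁ := hsq P.r P.a
  have h₂ := hsq P.u P.b
  simp only [Matrix.cons_val_zero, Matrix.cons_val_one] at h₁ h₂ ⊢
  rw [h₁, h₂]
  ring

/-- Coordinate projections are open maps, so weak bounds on a set become strict on its interior. -/
theorem disjoint_interior {P P' : Placement} {B B' : BoxIntegral.Box (Fin 3)} {ν ν' : Dir}
    (h : (P.planeRect B).Separated (P'.planeRect B')) :
    Disjoint (interior (P.map '' boxFace B ν)) (interior (P'.map '' boxFace B' ν')) := by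
  have hopen : ∀ i : Fin 2, IsOpenMap fun y : EuclideanSpace ℝ (Fin 2) => y i := fun i =>
    (EuclideanSpace.proj i : EuclideanSpace ℝ (Fin 2) →L[ℝ] ℝ).isOpenMap fun c =>
      ⟨WithLp.toLp 2 fun _ => c, rfl⟩
  have hIic : ∀ (s : Set (EuclideanSpace ℝ (Fin 2))) (i : Fin 2) (c : ℝ), (∀ y ∈ s, y i ≤ c) →
      ∀ y ∈ interior s, y i < c := by
    intro s i c hs y hy
    have := (hopen i).image_interior_subset s (Set.mem_image_of_mem _ hy)
    have := interior_mono (t := Set.Iic c) (by rintro _ ⟨y, hy, rfl⟩; exact hs y hy) this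
    rwa [interior_Iic] at this
  have hIci : ∀ (s : Set (EuclideanSpace ℝ (Fin 2))) (i : Fin 2) (c : ℝ), (∀ y ∈ s, c ≤ y i) →
      ∀ y ∈ interior s, c < y i := by
    intro s i c hs y hy
    have := (hopen i).image_interior_subset s (Set.mem_image_of_mem _ hy)
    have := interior_mono (t := Set.Ici c) (by rintro _ ⟨y, hy, rfl⟩; exact hs y hy) this
    rwa [interior_Ici] at this
  have hbd : ∀ (P : Placement) (B : BoxIntegral.Box (Fin 3)) (ν : Dir),
      ∀ y ∈ P.map '' boxFace B ν, ((P.planeRect B).left ≤ y 0 ∧ y 0 ≤ (P.planeRect B).right) ∧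
        (P.planeRect B).bottom ≤ y 1 ∧ y 1 ≤ (P.planeRect B).top := by
    rintro P B ν _ ⟨x, hx, rfl⟩
    have hx := mem_closedBox_iff.1 hx.1
    have h₁ := hx P.r
    have h₂ := hx P.r.opp
    have h₃ := hx P.u
    have h₄ := hx P.u.opp
    rw [Dir.coord_opp] at h₂ h₄
    simp only [planeRect, map, Matrix.cons_val_zero, Matrix.cons_val_one]
    refine ⟨⟨?_, ?_⟩, ?_, ?_⟩ <;> linarith
  rw [Set.disjoint_left]
  intro y hy hy'
  rcases h with h | h | h
  · have h₁ := hIic _ 1 _ (fun z hz => (hbd P B ν z hz).2.2) y hy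
    have h₂ := hIci _ 1 _ (fun z hz => (hbd P' B' ν' z hz).2.1) y hy'
    linarith
  · have h₁ := hIic _ 0 _ (fun z hz => (hbd P B ν z hz).1.2) y hy
    have h₂ := hIci _ 0 _ (fun z hz => (hbd P' B' ν' z hz).1.1) y hy'
    linarith
  · have h₁ := hIci _ 0 _ (fun z hz => (hbd P B ν z hz).1.1) y hy
    have h₂ := hIic _ 0 _ (fun z hz => (hbd P' B' ν' z hz).1.2) y hy'
    linarith

end Placement

namespace Orthotube

variable {n : ℕ} {T : Orthotube n}

theorem Crosses.axis_ne {f g : T.SurfaceFace} {d e : Dir} (h : T.Crosses f d g e) :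
    d.axis ≠ f.1.normal.axis := by cases h <;> assumption

theorem Crosses.rotation {f g : T.SurfaceFace} {d e : Dir} (h : T.Crosses f d g e) :
    (g.1.normal = d ∧ e = f.1.normal.opp) ∨ (g.1.normal = f.1.normal ∧ e = d) ∨
      (g.1.normal = d.opp ∧ e = f.1.normal) := by
  cases h with
  | convex _ _ hd hg => exact Or.inl ⟨by rw [hg], rfl⟩
  | flat _ _ hd j hj hg => exact Or.inr (Or.inl ⟨by rw [hg], rfl⟩)
  | reflex _ _ hd j k hj hk hg => exact Or.inr (Or.inr ⟨by rw [hg], rfl⟩)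

/-- The two faces at an edge, in terms of signed coordinates. -/
theorem Crosses.exists_shift {f g : T.SurfaceFace} {d e : Dir} (h : T.Crosses f d g e) :
    ∃ c : ℝ, (∀ x ∈ T.rect f ∩ T.rect g, e.coord x + c = d.coord x) ∧
      -e.opp.extent (T.box g.1.box) + c = d.extent (T.box f.1.box) ∧
      ∀ w : Dir, w.axis ≠ f.1.normal.axis → w.axis ≠ d.axis →
        w.extent (T.box g.1.box) = w.extent (T.box f.1.box) := by
  cases h with
  | convex _ _ hd hg =>
    -- On the edge both coordinates are constant; `c` is the difference between the `d`-coordinate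
    -- and the `e`-coordinate there, with `e` opposite to the normal of `f`.
    refine ⟨d.extent (T.box f.1.box) + f.1.normal.extent (T.box f.1.box), ?_, ?_, ?_⟩
    · rintro x ⟨hx, hy⟩
      rw [rect, mem_boxFace_iff] at hx hy
      rw [hg] at hy
      rw [Dir.coord_opp, hx.2, hy.2]
      ring
    · rw [hg, Dir.opp_opp]; ring
    · intro w _ _; rw [hg]
  | flat _ _ hd j hj hg =>
    refine ⟨0, by simp, ?_, ?_⟩
    · rw [hg, hj.gluedBoxes.extent_opp]; ring
    · intro w _ hw; rw [hg, hj.gluedBoxes.extent_eq w hw]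
  | reflex _ _ hd j k hj hk hg =>
    have hj := hj.gluedBoxes
    have hk := hk.gluedBoxes
    refine ⟨d.extent (T.box f.1.box) - f.1.normal.extent (T.box f.1.box), ?_, ?_, ?_⟩
    · rintro x ⟨hx, hy⟩
      rw [rect, mem_boxFace_iff] at hx hy
      rw [hg] at hy
      have h₁ := hy.2
      rw [Dir.coord_opp, hk.extent_eq d.opp hd, hj.extent_opp, neg_inj] at h₁
      rw [hx.2, h₁]
      ring
    · rw [hg, hk.extent_opp, hj.extent_eq _ hd.symm]; ring
    · intro w h₁ h₂; rw [hg, hk.extent_eq w h₁, hj.extent_eq w h₂]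

/-- The surface is flattened at the edge: the transverse coordinate is kept, and the one along the
motion is replaced by that of the entering direction, shifted to agree on the edge. -/
theorem Crosses.exists_placement {f g : T.SurfaceFace} {d e : Dir} (hc : T.Crosses f d g e)
    {P : Placement} (hF : IsFrame f.1.normal P.r P.u) {h : Turn} (hd : d = h.dir P.r P.u) :
    ∃ P' : Placement, IsFrame g.1.normal P'.r P'.u ∧ e = h.dir P'.r P'.u ∧
      Set.EqOn P.map P'.map (T.rect f ∩ T.rect g) ∧
      h.Beside (P.planeRect (T.box f.1.box)) (P'.planeRect (T.box g.1.box)) := by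
  obtain ⟨c, h₁, h₂, h₃⟩ := hc.exists_shift
  obtain ⟨r, u, a, b⟩ := P
  obtain ⟨a₁, a₂, a₃, v₁, v₂, v₃⟩ := hF
  simp only at a₁ a₂ a₃ v₁ v₂ v₃ hd
  have hF : IsFrame f.1.normal r u := ⟨a₁, a₂, a₃, v₁, v₂, v₃⟩
  have hrot := hc.rotation
  cases h with
  | S =>
    obtain rfl : d = u := hd
    refine ⟨⟨r, e, a, b + c⟩, ?_, rfl, ?_, ?_⟩
    · rcases hrot with ⟨hν, rfl⟩ | ⟨hν, rfl⟩ | ⟨hν, rfl⟩ <;> rw [hν]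
      exacts [hF.up, hF, by simpa only [Dir.opp_opp] using hF.up.opp_u]
    · intro x hx
      simp only [Placement.map, ← h₁ x hx]
      congr 3
      ring
    · have e₁ := h₃ r a₂ a₃
      have e₂ := h₃ r.opp a₂ a₃
      refine ⟨?_, ?_, ?_⟩ <;> simp only [Placement.planeRect] <;> linarith
  | R =>
    obtain rfl : d = r := hd
    refine ⟨⟨e, u, a + c, b⟩, ?_, rfl, ?_, ?_⟩
    · rcases hrot with ⟨hν, rfl⟩ | ⟨hν, rfl⟩ | ⟨hν, rfl⟩ <;> rw [hν]
      exacts [hF.right, hF, by simpa only [Dir.opp_opp] using hF.right.opp_r]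
    · intro x hx
      simp only [Placement.map, ← h₁ x hx]
      congr 2
      ring
    · have e₁ := h₃ u a₁ a₃.symm
      have e₂ := h₃ u.opp a₁ a₃.symm
      refine ⟨?_, ?_, ?_⟩ <;> simp only [Placement.planeRect] <;> linarith
  | L =>
    obtain rfl : d = r.opp := hd
    refine ⟨⟨e.opp, u, a - c, b⟩, ?_, (Dir.opp_opp e).symm, ?_, ?_⟩
    · rcases hrot with ⟨hν, rfl⟩ | ⟨hν, rfl⟩ | ⟨hν, rfl⟩ <;> rw [hν] <;> simp only [Dir.opp_opp]
      exacts [by simpa only [Dir.opp_opp] using hF.right.opp_r, hF, hF.right]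
    · intro x hx
      have := h₁ x hx
      rw [Dir.coord_opp] at this
      simp only [Placement.map, Dir.coord_opp]
      congr 2
      linarith
    · have e₁ := h₃ u a₁ a₃.symm
      have e₂ := h₃ u.opp a₁ a₃.symm
      refine ⟨?_, ?_, ?_⟩ <;> simp only [Placement.planeRect, Dir.opp_opp] <;> linarith

/-- The faces of a path are placed one after the other. -/
theorem Follows.exists_placements {f : T.SurfaceFace} {d : Dir} {U : ChainCode}
    {l : List T.SurfaceFace} (hl : T.Follows f d U l) :
    ∀ {h h' : Turn} {P : Placement}, U.foldlM Turn.add h = some h' →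
      IsFrame f.1.normal P.r P.u → d = h.dir P.r P.u →
      ∃ L : List (T.SurfaceFace × Placement), l = f :: L.map Prod.fst ∧
        (∀ p ∈ L, IsFrame p.1.1.normal p.2.r p.2.u) ∧
        ((f, P) :: L).IsChain (fun p q => Set.EqOn p.2.map q.2.map (T.rect p.1 ∩ T.rect q.1)) ∧
        Staircase h (P.planeRect (T.box f.1.box)) (L.map fun p => p.2.planeRect (T.box p.1.1.box)) := by
  induction hl with
  | nil f d => exact fun _ _ _ => ⟨[], rfl, by simp, by simp, .nil _ _⟩
  | cons f g d d' e t U l ht hc hl ih =>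
    intro h h' P hU hF hd
    simp only [List.foldlM_cons, Option.bind_eq_bind, Option.bind_eq_some_iff] at hU
    obtain ⟨h₁, hht, hU⟩ := hU
    obtain ⟨P', hF', he, heq, hb⟩ := hc.exists_placement hF (hF.dir_of_exits hht (hd ▸ ht))
    obtain ⟨L, rfl, k₁, k₂, k₃⟩ := ih hU hF' he
    refine ⟨(g, P') :: L, rfl, ?_, ?_, ?_⟩
    · simpa using ⟨hF', fun a b => k₁ (a, b)⟩
    · exact List.isChain_cons_cons.2 ⟨heq, k₂⟩
    · exact .cons hht hb k₃

theorem IsCorrespondingPath.unfoldsWithoutOverlap {U : ChainCode} {l : List T.SurfaceFace}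
    (hl : T.IsCorrespondingPath U l) {h : Turn} (hU : U.foldlM Turn.add .S = some h)
    (hnd : l.Nodup) : T.UnfoldsWithoutOverlap l := by
  obtain ⟨f₀, f₁, d, e, l', rfl, hc, hl⟩ := hl
  obtain ⟨r, hr⟩ := exists_isFrame hc.axis_ne
  obtain ⟨P, hF, he, heq, hb⟩ := hc.exists_placement (P := ⟨r, d, 0, 0⟩) hr (h := .S) rfl
  obtain ⟨L', rfl, k₁, k₂, k₃⟩ := hl.exists_placements hU hF he
  set L : List (T.SurfaceFace × Placement) := (f₀, ⟨r, d, 0, 0⟩) :: (f₁, P) :: L' with hL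
  have hfst : f₀ :: f₁ :: L'.map Prod.fst = L.map Prod.fst := rfl
  rw [hfst] at hnd ⊢
  -- No face occurs twice, so the list of placed faces is the graph of a function.
  have hex : ∃ F : T.SurfaceFace → Placement, ∀ p ∈ L, F p.1 = p.2 := by
    classical
    refine ⟨fun f => if hf : ∃ Q, (f, Q) ∈ L then hf.choose else ⟨r, d, 0, 0⟩, fun p hp => ?_⟩
    have hf : ∃ Q, (p.1, Q) ∈ L := ⟨p.2, hp⟩
    simp only [dif_pos hf]
    exact congrArg Prod.snd (List.inj_on_of_nodup_map hnd hf.choose_spec hp rfl)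
  obtain ⟨F, hFL⟩ := hex
  have hLF : (L.map Prod.fst).map (fun f => (f, F f)) = L := by
    rw [List.map_map]
    conv_rhs => rw [← List.map_id L]
    exact List.map_congr_left fun p hp => Prod.ext rfl (hFL p hp)
  refine ⟨fun f => (F f).map, ?_, ?_, ?_⟩
  · intro f hf
    obtain ⟨p, hp, rfl⟩ := List.mem_map.1 hf
    simp only [hFL p hp]
    refine Placement.isometry_map ?_ _
    rcases List.mem_cons.1 hp with rfl | hp
    · exact hr
    rcases List.mem_cons.1 hp with rfl | hp
    · exact hF
    · exact k₁ p hp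
  · have : L.IsChain (fun p q => Set.EqOn p.2.map q.2.map (T.rect p.1 ∩ T.rect q.1)) :=
      List.isChain_cons_cons.2 ⟨heq, k₂⟩
    rw [← hLF, List.isChain_map] at this
    exact this
  · have : L.Pairwise (fun p q => (p.2.planeRect (T.box p.1.1.box)).Separated
        (q.2.planeRect (T.box q.1.1.box))) := by
      have h₁ : (L.map fun p => p.2.planeRect (T.box p.1.1.box)).Pairwise PlaneRect.Separated :=
        (Staircase.cons (t := .S) (h := .S) rfl hb k₃).pairwise
      exact List.pairwise_map.1 h₁
    rw [← hLF, List.pairwise_map] at this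
    exact this.imp Placement.disjoint_interior

end Orthotube

/-! ### From the combinatorial model to the surface -/

theorem boxEdge_eq_of_boxFace_eq {B B' : BoxIntegral.Box (Fin 3)} {c d : Dir}
    (h : boxFace B d = boxFace B' d.opp) (hc : c.axis ≠ d.axis) :
    boxFace B c ∩ boxFace B d = boxFace B' c ∩ boxFace B' d.opp := by
  have hg := gluedBoxes_of_boxFace_eq h
  rw [← h]
  ext x
  refine and_congr_left fun hx => ?_
  have hx' := h ▸ hx
  rw [mem_boxFace_iff, mem_boxFace_iff, hg.extent_eq c hc]
  exact and_congr_left fun _ => ⟨fun _ => hx'.1, fun _ => hx.1⟩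

theorem SixDir.axis_apply_ne (t : Turn) {n d : SixDir} (h : d.toDir.axis ≠ n.toDir.axis) :
    (t.apply n d).toDir.axis ≠ n.toDir.axis := by
  revert n d
  cases t <;> decide

theorem SixDir.axis_ne_of_left :
    ∀ {c a : SixDir}, SixDir.left c a ≠ a → c.toDir.axis ≠ a.toDir.axis := by decide

theorem Turn.exits_apply (t : Turn) {n d : SixDir} (h : d.toDir.axis ≠ n.toDir.axis) :
    t.Exits n.toDir d.toDir (t.apply n d).toDir := by
  cases t
  exacts [SixDir.vec_left h.symm, SixDir.vec_left h, rfl]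

namespace Orthotube

variable {n : ℕ} {T : Orthotube n}

theorem Crosses.adj {f g : T.SurfaceFace} {d e : Dir} (h : T.Crosses f d g e) :
    T.faceAdjacencyGraph.Adj f g := by
  cases h with
  | convex _ _ hd hg =>
    refine ⟨?_, d, f.1.normal, hd, by rw [hg]; exact hd.symm, by rw [hg]; exact Set.inter_comm _ _⟩
    rintro rfl
    exact hd (congrArg (fun f : Face n => f.normal.axis) hg).symm
  | flat _ _ hd j hj hg =>
    refine ⟨?_, d, d.opp, hd, by rw [hg]; exact hd, ?_⟩
    · rintro rfl
      have := congrArg (fun f : Face n => f.box.val) hg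
      have := hj.1
      simp only at *
      omega
    · rw [hg]; exact boxEdge_eq_of_boxFace_eq hj.2 hd.symm
  | reflex _ _ hd j k hj hk hg =>
    refine ⟨?_, d, f.1.normal.opp, hd, by rw [hg]; exact hd.symm, ?_⟩
    · rintro rfl
      exact hd (congrArg (fun f : Face n => f.normal.axis) hg).symm
    -- At a reflex edge, the edge is carried from the box of `f` to the middle box `j`, and from
    -- there to the box `k` of `g`.
    · rw [hg, boxEdge, boxEdge, boxEdge_eq_of_boxFace_eq hj.2 hd.symm, Set.inter_comm]
      exact boxEdge_eq_of_boxFace_eq hk.2 hd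

theorem Follows.isChain {f : T.SurfaceFace} {d : Dir} {U : ChainCode} {l : List T.SurfaceFace}
    (h : T.Follows f d U l) :
    ∃ l', l = f :: l' ∧ (f :: l').IsChain T.faceAdjacencyGraph.Adj := by
  induction h with
  | nil f d => exact ⟨[], rfl, by simp⟩
  | cons f g d d' e t U l ht hc hl ih =>
    obtain ⟨l', rfl, hl'⟩ := ih
    exact ⟨_, rfl, List.isChain_cons_cons.2 ⟨hc.adj, hl'⟩⟩

theorem IsCorrespondingPath.isChain {U : ChainCode} {l : List T.SurfaceFace}
    (h : T.IsCorrespondingPath U l) : l ≠ [] ∧ l.IsChain T.faceAdjacencyGraph.Adj := by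
  obtain ⟨f₀, f₁, d, e, l', rfl, hc, hl⟩ := h
  obtain ⟨l', rfl, hl'⟩ := hl.isChain
  exact ⟨by simp, List.isChain_cons_cons.2 ⟨hc.adj, hl'⟩⟩

/-! ### Transfer of trails from the model to the orthotube. -/

/-- The face of the combinatorial model with outward normal `p.2` of the box number `p.1`,
counting from `1`. -/
def faceOf (n : ℕ) (p : ℕ × SixDir) : Face n := ⟨Fin.ofNat (n + 1) (p.1 - 1), p.2.toDir⟩

theorem val_box_faceOf {j : ℕ} (h₁ : 1 ≤ j) (h₂ : j ≤ n + 1) (f : SixDir) :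
    (faceOf n (j, f)).box.val = j - 1 := by
  simp only [faceOf, Fin.val_ofNat]
  exact Nat.mod_eq_of_lt (by omega)

theorem faceOf_inj {p q : ℕ × SixDir} (hp : 1 ≤ p.1 ∧ p.1 ≤ n + 1) (hq : 1 ≤ q.1 ∧ q.1 ≤ n + 1)
    (h : faceOf n p = faceOf n q) : p = q := by
  have h₁ := congrArg (fun f : Face n => f.box.val) h
  simp only [val_box_faceOf hp.1 hp.2, val_box_faceOf hq.1 hq.2] at h₁
  exact Prod.ext (by omega) (SixDir.toDir_injective (congrArg Face.normal h))

/-- The tube of the combinatorial model given by `e` is the orthotube `T`. -/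
def IsModel (T : Orthotube n) (e : ℕ → SixDir) : Prop :=
  ∀ (i j : Fin (n + 1)) (d : SixDir), T.Glued i d.toDir j ↔
    (i.val + 1 = j.val ∧ d = e (i + 1)) ∨ (j.val + 1 = i.val ∧ d = (e i).opp)

variable {e : ℕ → SixDir}

theorem IsModel.glued_succ (he : T.IsModel e) {j : ℕ} (h₁ : 1 ≤ j) (h₂ : j + 1 ≤ n + 1)
    (f f' : SixDir) :
    T.Glued (faceOf n (j, f)).box (e j).toDir (faceOf n (j + 1, f')).box := by
  rw [he, val_box_faceOf h₁ (by omega), val_box_faceOf (by omega) h₂]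
  exact Or.inl ⟨by omega, by rw [Nat.sub_add_cancel h₁]⟩

theorem IsModel.glued_pred (he : T.IsModel e) {j : ℕ} (h₁ : 1 ≤ j - 1) (h₂ : j ≤ n + 1)
    (f f' : SixDir) :
    T.Glued (faceOf n (j, f)).box (e (j - 1)).opp.toDir (faceOf n (j - 1, f')).box := by
  rw [he, val_box_faceOf (by omega) h₂, val_box_faceOf h₁ (by omega)]
  exact Or.inr ⟨by omega, rfl⟩

/-- The conditions on `j` discard the fictitious gluings, so the lemma covers the end caps as well.
-/
theorem IsModel.not_glued (he : T.IsModel e) {j : ℕ} (h₁ : 1 ≤ j) (h₂ : j ≤ n + 1) {f : SixDir}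
    (hf₁ : 2 ≤ j → f ≠ (e (j - 1)).opp) (hf₂ : j ≤ n → f ≠ e j) :
    ∀ i, ¬ T.Glued (faceOf n (j, f)).box (faceOf n (j, f)).normal i := by
  intro i hi
  have hi₂ := i.2
  rcases (he _ i f).1 hi with ⟨h, h'⟩ | ⟨h, h'⟩ <;>
    rw [val_box_faceOf h₁ h₂] at h h'
  · rw [Nat.sub_add_cancel h₁] at h'
    exact hf₂ (by omega) h'
  · exact hf₁ (by omega) h'

theorem IsModel.crosses (he : T.IsModel e) {s : Pos} (hs₁ : 1 ≤ s.box) (hs₂ : s.box ≤ n + 1)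
    (hs : s.out.toDir.axis ≠ s.normal.toDir.axis) (hq₁ : 1 ≤ (s.cross e).box)
    (hq₂ : (s.cross e).box ≤ n + 1) {f g : T.SurfaceFace}
    (hf : f.1 = faceOf n (s.box, s.normal))
    (hg : g.1 = faceOf n ((s.cross e).box, (s.cross e).normal)) :
    T.Crosses f s.out.toDir g (s.cross e).out.toDir ∧
      (s.cross e).out.toDir.axis ≠ (s.cross e).normal.toDir.axis := by
  obtain ⟨j, ν, o⟩ := s
  simp only at hs₁ hs₂ hs hf
  have hν : f.1.normal = ν.toDir := by rw [hf]; rfl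
  have hd : o.toDir.axis ≠ f.1.normal.axis := by rw [hν]; exact hs
  rw [Pos.cross_mk] at hq₁ hq₂ hg ⊢
  split_ifs at hq₁ hq₂ hg ⊢ with h₁ h₂ h₃ h₄
  · subst h₁ h₂
    refine ⟨?_, by simpa [SixDir.toDir_opp, Dir.opp_axis] using hs.symm⟩
    have h := Crosses.reflex f g _ hd _ _ (hf ▸ he.glued_succ hs₁ (by simp at hq₂; omega) _ .xp)
      (hν ▸ he.glued_succ (by omega) (by simpa using hq₂) _ .xp)
      (by rw [hg, ← SixDir.toDir_opp]; rfl)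
    rwa [hν] at h
  · subst h₁
    refine ⟨?_, hs⟩
    exact Crosses.flat f g _ hd _ (hf ▸ he.glued_succ hs₁ hq₂ _ .xp) (by rw [hg, hν]; rfl)
  · subst h₃ h₄
    refine ⟨?_, by simpa [SixDir.toDir_opp, Dir.opp_axis] using hs.symm⟩
    have h := Crosses.reflex f g _ hd _ _ (hf ▸ he.glued_pred (by simp at hq₁; omega) hs₂ _ .xp)
      (hν ▸ he.glued_pred (j := j - 1) (by simp at hq₁; omega) (by omega) _ .xp)
      (by rw [hg, ← SixDir.toDir_opp]; rfl)
    rwa [hν] at h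
  · subst h₃
    refine ⟨?_, hs⟩
    exact Crosses.flat f g _ hd _ (hf ▸ he.glued_pred hq₁ hs₂ _ .xp) (by rw [hg, hν]; rfl)
  · refine ⟨?_, by simpa [SixDir.toDir_opp, Dir.opp_axis] using hs.symm⟩
    have h := Crosses.convex f g o.toDir hd (by rw [hg, hf]; rfl)
    rwa [hν, ← SixDir.toDir_opp] at h

/-- The code ends about to leave the last box along the tube. One more crossing, which is convex,
leads to the end cap `c` and accounts for the appended face. -/
theorem IsModel.exists_follows (he : T.IsModel e) {X : SixDir} {c : T.SurfaceFace}
    (hc : c.1 = faceOf n (n + 1, e (n + 1))) (U : List Turn) :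
    ∀ (s : Pos) (f : T.SurfaceFace), U ≠ [] →
      f.1 = faceOf n ((s.cross e).box, (s.cross e).normal) →
      (s.cross e).out.toDir.axis ≠ (s.cross e).normal.toDir.axis →
      (∀ p ∈ trail e s U, (1 ≤ p.1 ∧ p.1 ≤ n + 1) ∧ IsFree e p.1 p.2) →
      U.foldl (Pos.step e) s = ⟨n + 1, X, e (n + 1)⟩ →
      ∃ l : List T.SurfaceFace, l.map Subtype.val = (trail e s U).map (faceOf n) ∧
        T.Follows f (s.cross e).out.toDir U (l ++ [c]) := by
  induction U with
  | nil => intro s f h; exact absurd rfl h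
  | cons t U ih =>
    intro s f _ hf hperp htr hlast
    set s' := s.step e t with hs'
    have hbox : s'.box = (s.cross e).box := rfl
    have hnor : s'.normal = (s.cross e).normal := rfl
    have hout : s'.out = t.apply (s.cross e).normal (s.cross e).out := rfl
    have hν : f.1.normal = (s.cross e).normal.toDir := by rw [hf]; rfl
    have hex : t.Exits f.1.normal (s.cross e).out.toDir s'.out.toDir := by
      rw [hν, hout]; exact t.exits_apply hperp
    have hperp' : s'.out.toDir.axis ≠ s'.normal.toDir.axis := by
      rw [hout, hnor]; exact SixDir.axis_apply_ne t hperp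
    rw [trail] at htr ⊢
    have hs := (htr _ List.mem_cons_self).1
    cases U with
    | nil =>
      have hlast : s' = ⟨n + 1, X, e (n + 1)⟩ := hlast
      refine ⟨[f], congrArg (fun a => [a]) hf, ?_⟩
      refine .cons f c _ _ _ t [] [c] hex (.convex f c _ ?_ ?_) (.nil _ _)
      · rw [hν, ← hnor]; exact hperp'
      · rw [hc, hf, ← hbox, hlast]; rfl
    | cons t' U =>
      have hq := htr ((s'.cross e).box, (s'.cross e).normal)
        (List.mem_cons_of_mem _ List.mem_cons_self)
      have hsurf := he.not_glued hq.1.1 hq.1.2 (fun _ => hq.2.1) (fun _ => hq.2.2)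
      obtain ⟨hcr, hp⟩ := he.crosses hs.1 hs.2 hperp' hq.1.1 hq.1.2 (f := f)
        (g := ⟨_, hsurf⟩) hf rfl
      obtain ⟨l, hl, hfol⟩ := ih s' ⟨_, hsurf⟩ (by simp) rfl hp
        (fun p hp => htr p (List.mem_cons_of_mem _ hp)) hlast
      exact ⟨f :: l, congrArg₂ List.cons hf hl,
        .cons f _ _ _ _ t _ _ hex hcr hfol⟩

theorem exists_path (T : Orthotube n) : ∃ (U : ChainCode) (l : List T.SurfaceFace) (h : Turn),
    T.IsCorrespondingPath U l ∧ l.Nodup ∧ (∀ f, f ∈ l) ∧ U.foldlM Turn.add .S = some h := by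
  obtain ⟨e, he₁, he₂, he0, hen, he⟩ := T.exists_directions
  have he : T.IsModel e := he
  obtain ⟨c, hc⟩ : ∃ c, SixDir.left c (e 0) ≠ e 0 := by
    generalize e 0 = a
    revert a; decide
  -- The sweep starts on the fictitious box 0; both members of this pair have turning `.S`, as a
  -- path starting at the cap requires.
  have hgood : IsGoodPair (e 0) (e 0) [(c, .S), (c.opp, .S)] :=
    ⟨_, isRotation_frame hc, rfl, Or.inl ⟨rfl, _, List.mem_cons_self, rfl⟩⟩
  obtain ⟨⟨X, t₀⟩, hXm, ⟨X', h⟩, U, hU, hlast, hnd, hmem⟩ :=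
    hgood.exists_sweep he₁ he₂ hen (Nat.zero_le n) (he₁ 0)
  have hX : X.toDir.axis ≠ (e 0).toDir.axis ∧ t₀ = .S := by
    simp only [List.mem_cons, Prod.mk.injEq, List.not_mem_nil, or_false] at hXm
    have : c.toDir.axis ≠ (e 0).toDir.axis := SixDir.axis_ne_of_left hc
    rcases hXm with ⟨rfl, h⟩ | ⟨rfl, h⟩
    · exact ⟨this, h⟩
    · exact ⟨by rw [SixDir.toDir_opp]; exact this, h⟩
  clear hXm
  obtain ⟨hX, rfl⟩ := hX
  simp only at hU hlast hnd hmem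
  set s : Pos := ⟨0, X, e 0⟩ with hs
  have hcross : s.cross e = ⟨1, X, e 0⟩ := by
    rw [hs, Pos.cross_mk, if_pos rfl, if_neg]
    intro h
    exact hX (by rw [h, zero_add, he0])
  have hUne : U ≠ [] := by
    rintro rfl
    have := congrArg Pos.box hlast
    simp [hs] at this
  have hXfree : IsFree e 1 X := by
    refine ⟨?_, ?_⟩
    · intro h; exact hX (by rw [h, SixDir.toDir_opp]; rfl)
    · intro h; exact hX (by rw [h, he0])
  have hc₀ : ∀ i, ¬ T.Glued (faceOf n (1, (e 0).opp)).box (faceOf n (1, (e 0).opp)).normal i :=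
    he.not_glued le_rfl (by omega) (by omega) fun _ => by rw [he0]; exact SixDir.opp_ne _
  have hc₁ : ∀ i, ¬ T.Glued (faceOf n (n + 1, e (n + 1))).box
      (faceOf n (n + 1, e (n + 1))).normal i :=
    he.not_glued (by omega) le_rfl (fun _ => by rw [Nat.add_sub_cancel]; exact he₁ n) (by omega)
  have hf₁ : ∀ i, ¬ T.Glued (faceOf n (1, X)).box (faceOf n (1, X)).normal i :=
    he.not_glued le_rfl (by omega) (by omega) fun _ => hXfree.2
  have htr : ∀ p ∈ trail e s U, (1 ≤ p.1 ∧ p.1 ≤ n + 1) ∧ IsFree e p.1 p.2 :=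
    fun p hp => (hmem p.1 p.2).1 hp
  obtain ⟨l, hl, hfol⟩ := he.exists_follows (c := ⟨_, hc₁⟩) rfl U s ⟨_, hf₁⟩ hUne
    (by rw [hcross]) (by rw [hcross]; exact hX.symm) htr hlast
  rw [hcross] at hfol
  have hcr : T.Crosses ⟨_, hc₀⟩ X.toDir ⟨_, hf₁⟩ (e 0).toDir := by
    have h := Crosses.convex (T := T) ⟨_, hc₀⟩ ⟨_, hf₁⟩ X.toDir
      (by simpa [faceOf, SixDir.toDir_opp, Dir.opp_axis] using hX) rfl
    rwa [show (faceOf n (1, (e 0).opp)).normal.opp = (e 0).toDir by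
      simp [faceOf, SixDir.toDir_opp, Dir.opp_opp]] at h
  have hval : (⟨_, hc₀⟩ :: (l ++ [⟨_, hc₁⟩]) : List T.SurfaceFace).map Subtype.val =
      ((1, (e 0).opp) :: (trail e s U ++ [(n + 1, e (n + 1))])).map (faceOf n) := by
    refine congrArg (List.cons _) ?_
    rw [List.map_append, ← hl]
    exact List.map_append
  refine ⟨U, ⟨_, hc₀⟩ :: (l ++ [⟨_, hc₁⟩]), h, ⟨_, _, _, _, _, rfl, hcr, hfol⟩, ?_, ?_, hU⟩
  · refine List.Nodup.of_map Subtype.val ?_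
    rw [hval]
    refine List.Nodup.map_on ?_ ?_
    · have hrange : ∀ p ∈ (1, (e 0).opp) :: (trail e s U ++ [(n + 1, e (n + 1))]),
          1 ≤ p.1 ∧ p.1 ≤ n + 1 := by
        intro p hp
        simp only [List.mem_cons, List.mem_append, List.not_mem_nil, or_false] at hp
        rcases hp with rfl | hp | rfl
        · simp
        · exact (htr p hp).1
        · simp
      exact fun p hp q hq => faceOf_inj (hrange p hp) (hrange q hq)
    -- The two caps are not free in the sense of `IsFree`, because the fictitious steps pass through
    -- them; hence they are not on the trail.
    · have h₀ : (1, (e 0).opp) ∉ trail e s U := fun hp => (htr _ hp).2.1 rfl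
      have h₁ : (n + 1, e (n + 1)) ∉ trail e s U := fun hp => (htr _ hp).2.2 rfl
      have h₂ : (1, (e 0).opp) ≠ (n + 1, e (n + 1)) := by
        intro h
        obtain ⟨hn, h⟩ := Prod.mk.inj h
        obtain rfl : n = 0 := by omega
        exact he₁ 0 h.symm
      rw [List.nodup_cons, List.nodup_append]
      simp only [List.mem_append, List.mem_singleton]
      exact ⟨by tauto, hnd, List.nodup_singleton _, fun a ha b hb hab => h₁ (by rwa [← hb, ← hab])⟩
  · intro f
    suffices hf : f.1 ∈ (⟨_, hc₀⟩ :: (l ++ [⟨_, hc₁⟩]) : List T.SurfaceFace).map Subtype.val by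
      obtain ⟨g, hg, hgf⟩ := List.mem_map.1 hf
      rwa [← Subtype.ext hgf]
    rw [hval]
    obtain ⟨⟨i, ν⟩, hf⟩ := f
    obtain ⟨ν, rfl⟩ := SixDir.toDir_surjective ν
    have hi := i.2
    have hfi : (⟨i, ν.toDir⟩ : Face n) = faceOf n (i + 1, ν) := by
      rw [faceOf, Nat.add_sub_cancel, Fin.ofNat_eq_cast, Fin.cast_val_eq_self]
    simp only [List.map_cons, List.map_append, List.mem_cons, List.mem_append]
    -- A face pointing backwards or forwards along the tube is an end cap, as otherwise it would be
    -- glued; all other faces are free and swept.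
    by_cases h₁ : ν = (e i).opp
    · left
      rcases Nat.eq_zero_or_pos i.val with h0 | h0
      · rw [hfi, h₁, h0]
      · exact absurd ((he i ⟨i - 1, by omega⟩ ν).2 (Or.inr ⟨by simp only; omega, h₁⟩)) (hf _)
    by_cases h₂ : ν = e (i + 1)
    · right; right
      rcases Nat.eq_or_lt_of_le (Nat.le_of_lt_succ hi) with h0 | h0
      · rw [hfi, h₂, h0]; simp
      · exact absurd ((he i ⟨i + 1, by omega⟩ ν).2 (Or.inl ⟨rfl, h₂⟩)) (hf _)
    · right; left
      rw [hfi]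
      exact List.mem_map_of_mem ((hmem _ _).2 ⟨⟨by omega, by omega⟩, h₁, h₂⟩)

end Orthotube

end OrthotubeUnfolding

theorem mainTheorem1 (n : ℕ) (T : OrthotubeUnfolding.Orthotube n) :
    ∃ (U : OrthotubeUnfolding.ChainCode) (f g : T.SurfaceFace)
      (p : T.faceAdjacencyGraph.Walk f g),
      p.IsHamiltonian ∧
      T.IsCorrespondingPath U p.support ∧
      (∀ P : OrthotubeUnfolding.ChainCode, P <+: U →
        OrthotubeUnfolding.quarterTurning P ∈ ({-1, 0, 1} : Set ℤ)) ∧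
      OrthotubeUnfolding.SquaresDoNotOverlap U ∧
      T.UnfoldsWithoutOverlap p.support := by
  obtain ⟨U, l, h, hl, hnd, hall, hU⟩ := T.exists_path
  obtain ⟨hne, hchain⟩ := hl.isChain
  refine ⟨U, _, _, SimpleGraph.Walk.ofSupport l hne hchain, ?_, ?_,
    fun P hP => OrthotubeUnfolding.quarterTurning_mem_of_foldlM hU hP,
    OrthotubeUnfolding.squaresDoNotOverlap_of_foldlM hU, ?_⟩
  · intro f
    rw [SimpleGraph.Walk.support_ofSupport]
    exact List.count_eq_one_of_mem hnd (hall f)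
  · rwa [SimpleGraph.Walk.support_ofSupport]
  · rw [SimpleGraph.Walk.support_ofSupport]
    exact hl.unfoldsWithoutOverlap hU hnd
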